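/- Let $p$ be a prime, let $n$ be a natural number with $p$-adic expansion $n=\sum_{i=1}^t a_ip^{k_i}$, where $k_1>\dots>k_t\ge 0$ and $1\le a_i\le p-1$, and let $q_t=a_1+\dots+a_t$. Let $P_{1}=1$, let $P_p=\langle\gamma\rangle\le S_p$ with $\gamma=(1,2,\dots,p)$, let $P_{p^k}=P_{p^{k-1}}\wr P_p\le S_{p^k}$ (acting on $p$ consecutive blocks of length $p^{k-1}$), and let $P_n=\prod_{i=1}^t (P_{p^{k_i}})^{\times a_i}\le S_n$, the factors acting on consecutive blocks of points; this is a Sylow $p$-subgroup of $S_n$. For $1\le j\le q_t$ let $o(j)$ be the exponent $k_i$ of the $j$-th factor. Let $\omega=e^{2\pi i/p}$ and, for $0\le\varepsilon\le p-1$, let $\phi_\varepsilon$ be the linear character of $P_p$ with $\phi_\varepsilon(\gamma)=\omega^\varepsilon$. Tree functions. Let $\mathrm{sk}_{p^k}$ be the set of all sequences of length at most $k-1$ with symbols in $\{1,\dots,p\}$ (empty if $k=0$). A $p^k$-labeling function is a map $t:\mathrm{sk}_{p^k}\to\{0,\dots,p\}$. Write $t_1\sim t_2$ if there are elements $\gamma_q\in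 P_p$, indexed by sequences $q$, with $t_1(s_1\dots s_\ell)=t_2\big((s_1)\gamma_{\emptyset}\,(s_2)\gamma_{s_1}\cdots(s_\ell)\gamma_{s_1\dots s_{\ell-1}}\big)$ for all $s_1\dots s_\ell\in\mathrm{sk}_{p^k}$. A $p^k$-tree function is an equivalence class of labeling functions. Write $(T_1\mid\dots\mid T_p;\varepsilon)$ for the class of a labeling function with label $\varepsilon$ at the empty sequence and whose subfunctions $q\mapsto t(iq)$ represent $T_i$. The only $p^0$-tree function is admissible, and for $k\ge1$ the tree function $(T_1\mid\dots\mid T_p;\varepsilon)$ is admissible if all $T_i$ are admissible and they are all equal when $\varepsilon\le p-1$, and not all equal when $\varepsilon=p$. An admissible $n$-tree function is a tuple $(\mathcal T_1,\dots,\mathcal T_{q_t})$ of admissible $p^{o(j)}$-tree functions $\mathcal T_j$. Correspondence. To $\theta\in\mathrm{Irr}(P_{p^k})$ one assigns a tree function $\mathcal T(\theta)$ recursively. The trivial character of $P_1$ has the unique $p^0$-tree function. For $k\ge1$: if $\theta=\mathcal X(\phi;\phi_\varepsilon)$ with $\phi\in\mathrm{Irr}(P_{p^{k-1}})$ and $0\le\varepsilon\le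 p-1$ (the product of the character of the natural $P_{p^{k-1}}\wr P_p$-module $V^{\otimes p}$, where $V$ affords $\phi$, with the inflation of $\phi_\varepsilon$), then $\mathcal T(\theta)=(\mathcal T(\phi)\mid\dots\mid\mathcal T(\phi);\varepsilon)$; if $\theta=(\theta_1\times\dots\times\theta_p)\!\uparrow^{P_{p^k}}$ is induced from the base group, with $\theta_i\in\mathrm{Irr}(P_{p^{k-1}})$ not all equal, then $\mathcal T(\theta)=(\mathcal T(\theta_1)\mid\dots\mid\mathcal T(\theta_p);p)$. For $\theta=\theta_1\times\dots\times\theta_{q_t}\in\mathrm{Irr}(P_n)$ with $\theta_j\in\mathrm{Irr}(P_{p^{o(j)}})$ put $\mathcal T(\theta)=(\mathcal T(\theta_1),\dots,\mathcal T(\theta_{q_t}))$. Galois action. Let $\sigma$ be a generator of $\mathrm{Gal}(\mathbb Q(\omega)/\mathbb Q)$, let $1\le b\le p-1$ with $\sigma(\omega)=\omega^b$, and let $\tau$ be the permutation of $\{0,\dots,p\}$ that fixes $p$ and sends each $\varepsilon\in\{0,\dots,p-1\}$ to the residue of $b\varepsilon$ modulo $p$. For a character $\theta$ with values in $\mathbb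 Q(\omega)$ let $\theta^\sigma(g)=\sigma(\theta(g))$. Theorem. The map $\theta\mapsto\mathcal T(\theta)$ is a well-defined bijection from $\mathrm{Irr}(P_n)$ to the set of admissible $n$-tree functions. Every $\theta\in\mathrm{Irr}(P_n)$ has its values in $\mathbb Q(\omega)$, and $\theta^\sigma\in\mathrm{Irr}(P_n)$. Hence $\sigma$ acts on the admissible $n$-tree functions by $\mathcal T(\theta)^\sigma:=\mathcal T(\theta^\sigma)$, and this action applies $\tau$ to every label in each component: if $\mathcal T(\theta)=(\mathcal T_1,\dots,\mathcal T_{q_t})$ and $t_j$ is a labeling function that represents $\mathcal T_j$, then $\mathcal T(\theta)^\sigma$ is represented by the labeling functions $s\mapsto (t_j(s))\tau$ for $s\in\mathrm{sk}_{p^{o(j)}}$ and $1\le j\le q_t$. -/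

import Mathlib

open Equiv

/-! ## The Sylow subgroups `P_{p^k}` and `P_n` as permutation groups -/

namespace SylowTree

/-- The permutation of `p` copies of `X` (the points `(i, x)`, with `i` the number of the copy)
given by `(f; δ) : (i, x) ↦ (δ i, f (δ i) x)`. -/
def wreathAct {p : ℕ} {X : Type} (f : Fin p → Perm X) (δ : Perm (Fin p)) : Perm (Fin p × X) where
  toFun z := (δ z.1, f (δ z.1) z.2)
  invFun z := (δ⁻¹ z.1, (f z.1)⁻¹ z.2)
  left_inv z := by simp
  right_inv z := by simp

/-- The numbering `(i, x) ↦ i * p ^ k + x` of the points of `p` consecutive blocks of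
length `p ^ k`. -/
def blockEquiv (p k : ℕ) : Fin p × Fin (p ^ k) ≃ Fin (p ^ (k + 1)) :=
  finProdFinEquiv.trans (finCongr (pow_succ' p k).symm)

/-- The element `(f_1, …, f_p; δ)` of `S_{p^k} ≀ S_p` as a permutation of `p ^ (k + 1)` points. -/
def wreathPerm {p k : ℕ} (f : Fin p → Perm (Fin (p ^ k))) (δ : Perm (Fin p)) :
    Perm (Fin (p ^ (k + 1))) :=
  (blockEquiv p k).permCongrHom (wreathAct f δ)

theorem wreathPerm_mul {p k : ℕ} (f g : Fin p → Perm (Fin (p ^ k))) (δ η : Perm (Fin p)) :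
    wreathPerm f δ * wreathPerm g η = wreathPerm (fun i => f i * g (δ⁻¹ i)) (δ * η) := by
  unfold wreathPerm
  rw [← map_mul]
  congr 1
  ext z <;> simp [wreathAct]

theorem wreathPerm_one {p k : ℕ} :
    wreathPerm (1 : Fin p → Perm (Fin (p ^ k))) 1 = 1 := by
  unfold wreathPerm
  rw [← map_one (blockEquiv p k).permCongrHom]
  congr 1

theorem wreathPerm_inv {p k : ℕ} (f : Fin p → Perm (Fin (p ^ k))) (δ : Perm (Fin p)) :
    (wreathPerm f δ)⁻¹ = wreathPerm (fun i => (f (δ i))⁻¹) δ⁻¹ := by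
  rw [inv_eq_iff_mul_eq_one, wreathPerm_mul, ← wreathPerm_one]
  congr 1
  · funext i
    simp
  · simp

/-- The group `H ≀ P_p`, where `P_p` is generated by the `p`-cycle `(1, 2, …, p)`. -/
def wreathSubgroup {p k : ℕ} (H : Subgroup (Perm (Fin (p ^ k)))) :
    Subgroup (Perm (Fin (p ^ (k + 1)))) where
  carrier := {g | ∃ f : Fin p → Perm (Fin (p ^ k)), ∃ δ ∈ Subgroup.zpowers (finRotate p),
    (∀ i, f i ∈ H) ∧ wreathPerm f δ = g}
  one_mem' := ⟨1, 1, one_mem _, fun _ => one_mem _, wreathPerm_one⟩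
  mul_mem' := by
    rintro _ _ ⟨f, δ, hδ, hf, rfl⟩ ⟨g, η, hη, hg, rfl⟩
    exact ⟨_, _, mul_mem hδ hη, fun i => mul_mem (hf i) (hg _), (wreathPerm_mul f g δ η).symm⟩
  inv_mem' := by
    rintro _ ⟨f, δ, hδ, hf, rfl⟩
    exact ⟨_, _, inv_mem hδ, fun i => inv_mem (hf _), (wreathPerm_inv f δ).symm⟩

/-- The Sylow `p`-subgroup `P_{p^k} = P_{p^{k-1}} ≀ P_p` of `S_{p^k}`, with `P_1` trivial. -/
def sylPow (p : ℕ) : (k : ℕ) → Subgroup (Perm (Fin (p ^ k)))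
  | 0 => ⊥
  | k + 1 => wreathSubgroup (sylPow p k)

/-- The element `(f_1, …, f_p; γ ^ s)` of `P_{p^{k+1}}`, where `γ = (1, 2, …, p)`. -/
def wreathElt {p k : ℕ} (f : Fin p → sylPow p k) (s : ℕ) : sylPow p (k + 1) :=
  ⟨wreathPerm (fun i => (f i : Perm (Fin (p ^ k)))) (finRotate p ^ s),
    _, _, Subgroup.npow_mem_zpowers _ s, fun i => (f i).2, rfl⟩

/-- The inclusion of the base group `(P_{p^k})^{× p}` into `P_{p^{k+1}}`. -/
def baseHom (p k : ℕ) : (Fin p → sylPow p k) →* sylPow p (k + 1) where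
  toFun f := wreathElt f 0
  map_one' := Subtype.ext wreathPerm_one
  map_mul' f g := by
    apply Subtype.ext
    simp only [wreathElt, Subgroup.coe_mul, pow_zero, wreathPerm_mul, Pi.mul_apply]
    simp

/-- The `p`-adic expansion `n = ∑ a_i p ^ {k_i}`, with `k_1 > k_2 > ⋯ ≥ 0` and
`1 ≤ a_i ≤ p - 1`. -/
structure PadicExpansion (p n : ℕ) where
  /-- the number of terms -/
  t : ℕ
  /-- the nonzero digits -/
  a : Fin t → ℕ
  /-- the exponents -/
  k : Fin t → ℕ
  k_anti : StrictAnti k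
  a_pos : ∀ i, 1 ≤ a i
  a_le : ∀ i, a i ≤ p - 1
  sum_eq : n = ∑ i, a i * p ^ k i

namespace PadicExpansion

variable {p n : ℕ} (E : PadicExpansion p n)

/-- The set of the `q_t = a_1 + ⋯ + a_t` direct factors of `P_n`, numbered by the pairs `(i, j)`
with `1 ≤ i ≤ t` and `1 ≤ j ≤ a_i`. -/
abbrev Factor : Type := (i : Fin E.t) × Fin (E.a i)

/-- The numbering `(i, j, x) ↦ (∑_{z < i} a_z p ^ {k_z}) + j p ^ {k_i} + x` of `n` points. -/
def pointEquiv : ((i : Fin E.t) × (Fin (E.a i) × Fin (p ^ E.k i))) ≃ Fin n :=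
  ((Equiv.sigmaCongrRight fun _ => finProdFinEquiv).trans finSigmaFinEquiv).trans
    (finCongr E.sum_eq.symm)

/-- The permutation that acts by `x (i, j)` on the block numbered `(i, j)`. -/
def blockAct (x : (c : E.Factor) → Perm (Fin (p ^ E.k c.1))) :
    Perm ((i : Fin E.t) × (Fin (E.a i) × Fin (p ^ E.k i))) where
  toFun z := ⟨z.1, z.2.1, x ⟨z.1, z.2.1⟩ z.2.2⟩
  invFun z := ⟨z.1, z.2.1, (x ⟨z.1, z.2.1⟩)⁻¹ z.2.2⟩
  left_inv z := by simp
  right_inv z := by simp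

/-- The homomorphism from the direct product of the groups `P_{p^{k_i}}` (`a_i` copies for
each `i`) to `S_n`, each factor acting on its own block of consecutive points. -/
def blockHom : ((c : E.Factor) → sylPow p (E.k c.1)) →* Perm (Fin n) where
  toFun x := E.pointEquiv.permCongrHom (E.blockAct fun c => (x c : Perm (Fin (p ^ E.k c.1))))
  map_one' := by
    rw [← map_one E.pointEquiv.permCongrHom]
    congr 1
  map_mul' x y := by
    rw [← map_mul]
    congr 1

/-- The Sylow `p`-subgroup `P_n` of `S_n`. -/
def sylow : Subgroup (Perm (Fin n)) := E.blockHom.range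

end PadicExpansion

/-! ## Characters -/

/-- `χ` is the character of an irreducible complex representation of (the finite group) `G`. -/
def IsIrrChar {G : Type} [Group G] (χ : G → ℂ) : Prop :=
  ∃ (d : ℕ) (ρ : Representation ℂ G (Fin d → ℂ)), ρ.IsIrreducible ∧ ρ.character = χ

/-- `ω = e ^ {2 π i / p}`. -/
noncomputable def omega (p : ℕ) : ℂ := Complex.exp (2 * Real.pi * Complex.I / p)

open scoped TensorProduct in
/-- The map `v_1 ⊗ ⋯ ⊗ v_p ↦ A_1 v_{δ⁻¹ 1} ⊗ ⋯ ⊗ A_p v_{δ⁻¹ p}` on the tensor power `V^{⊗ p}`. -/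
noncomputable def tensorAct {p : ℕ} {V : Type} [AddCommGroup V] [Module ℂ V]
    (A : Fin p → V →ₗ[ℂ] V) (δ : Perm (Fin p)) :
    (⨂[ℂ] _ : Fin p, V) →ₗ[ℂ] (⨂[ℂ] _ : Fin p, V) :=
  PiTensorProduct.map A ∘ₗ (PiTensorProduct.reindex ℂ (fun _ => V) δ).toLinearMap

/-- `θ = 𝒳(φ; ε)`: the product of the character of `P_{p^k} ≀ P_p` on `V^{⊗ p}`, where `V` affords
`φ`, and of the inflation of the linear character `φ_ε` of `P_p`, which has
`φ_ε(γ) = ω ^ ε` at `γ = (1, 2, …, p)`. -/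
def IsWreathChar {p k : ℕ} (θ : sylPow p (k + 1) → ℂ) (φ : sylPow p k → ℂ) (ε : ℕ) : Prop :=
  ∃ (d : ℕ) (ρ : Representation ℂ (sylPow p k) (Fin d → ℂ)), ρ.character = φ ∧
    ∀ (f : Fin p → sylPow p k) (s : ℕ), θ (wreathElt f s) =
      LinearMap.trace ℂ _ (tensorAct (fun i => ρ (f i)) (finRotate p ^ s)) * (omega p ^ ε) ^ s

/-- The class function of the finite group `G` induced from the class function `ψ` of the finite
group `H`, regarded as a subgroup of `G` through the injective homomorphism `ι`:
`g ↦ |H|⁻¹ ∑_{x ∈ G, x⁻¹ g x ∈ H} ψ (x⁻¹ g x)`. -/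
noncomputable def inducedChar {H G : Type} [Group H] [Group G] (ι : H →* G) (ψ : H → ℂ) (g : G) :
    ℂ :=
  (Nat.card H : ℂ)⁻¹ * ∑ᶠ (x : G) (h : H) (_ : ι h = x⁻¹ * g * x), ψ h

/-- The character `(θ_1 × ⋯ × θ_p) ↑ P_{p^{k+1}}` induced from the base group. -/
noncomputable def inducedFromBase {p k : ℕ} (φ : Fin p → sylPow p k → ℂ) :
    sylPow p (k + 1) → ℂ :=
  inducedChar (baseHom p k) fun f => ∏ i, φ i (f i)

/-! ## Labeling functions and tree functions -/

/-- The `p^k`-skeleton: the sequences of length at most `k - 1` with `p` possible symbols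
(no sequence at all if `k = 0`). -/
abbrev Skeleton (p k : ℕ) : Type := {s : List (Fin p) // s.length < k}

/-- The `p^k`-labeling functions, with labels in `[0, p]`. -/
abbrev Labeling (p k : ℕ) : Type := Skeleton p k → Fin (p + 1)

/-- The sequence `(s_1)γ_∅ (s_2)γ_{s_1} (s_3)γ_{s_1 s_2} …`, where each `γ_q` lies in
`P_p = ⟨(1, 2, …, p)⟩`. -/
def twist {p : ℕ} (γ : List (Fin p) → Subgroup.zpowers (finRotate p)) (s : List (Fin p)) :
    List (Fin p) :=
  s.mapIdx fun i x => (γ (s.take i) : Perm (Fin p)) x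

theorem length_twist {p : ℕ} (γ : List (Fin p) → Subgroup.zpowers (finRotate p))
    (s : List (Fin p)) : (twist γ s).length = s.length := by
  simp [twist]

theorem twist_nil {p : ℕ} (γ : List (Fin p) → Subgroup.zpowers (finRotate p)) :
    twist γ [] = [] := by
  simp [twist]

theorem twist_cons {p : ℕ} (γ : List (Fin p) → Subgroup.zpowers (finRotate p)) (x : Fin p)
    (s : List (Fin p)) :
    twist γ (x :: s) = (γ [] : Perm (Fin p)) x :: twist (fun q => γ (x :: q)) s := by
  simp [twist, List.mapIdx_cons]

theorem twist_one {p : ℕ} (s : List (Fin p)) : twist (fun _ => 1) s = s := by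
  induction s with
  | nil => exact twist_nil _
  | cons x s ih => rw [twist_cons, ih]; rfl

theorem exists_twist_twist {p : ℕ} (γ δ : List (Fin p) → Subgroup.zpowers (finRotate p)) :
    ∃ η : List (Fin p) → Subgroup.zpowers (finRotate p),
      ∀ s, twist δ (twist γ s) = twist η s := by
  refine ⟨fun q => δ (twist γ q) * γ q, fun s => ?_⟩
  induction s generalizing γ δ with
  | nil => simp [twist_nil]
  | cons x s ih =>
    simp only [twist_cons, twist_nil, ih]
    rfl

/-- The sequence that `twist γ` maps to the given one. -/
def untwist {p : ℕ} : (List (Fin p) → Subgroup.zpowers (finRotate p)) → List (Fin p) →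
    List (Fin p)
  | _, [] => []
  | γ, x :: s => (γ [] : Perm (Fin p))⁻¹ x ::
      untwist (fun q => γ ((γ [] : Perm (Fin p))⁻¹ x :: q)) s

theorem exists_twist_inverse {p : ℕ} (γ : List (Fin p) → Subgroup.zpowers (finRotate p)) :
    ∃ δ : List (Fin p) → Subgroup.zpowers (finRotate p), ∀ s, twist γ (twist δ s) = s := by
  have h1 : ∀ (s : List (Fin p)) (γ : List (Fin p) → Subgroup.zpowers (finRotate p)),
      twist γ (untwist γ s) = s := by
    intro s
    induction s with
    | nil => intro γ; simp [untwist, twist_nil]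
    | cons x s ih => intro γ; simp [untwist, twist_cons, ih]
  have h2 : ∀ (s : List (Fin p)) (γ : List (Fin p) → Subgroup.zpowers (finRotate p)),
      twist (fun q => (γ (untwist γ q))⁻¹) s = untwist γ s := by
    intro s
    induction s with
    | nil => intro γ; simp [untwist, twist_nil]
    | cons x s ih =>
      intro γ
      simp only [twist_cons, untwist, ← ih]
      rfl
  exact ⟨fun q => (γ (untwist γ q))⁻¹, fun s => by rw [h2, h1]⟩

/-- The equivalence relation on labeling functions: `t₁ ∼ t₂` if there are `γ_q ∈ P_p` with
`t₁(s) = t₂((s_1)γ_∅ (s_2)γ_{s_1} …)` for all `s`. -/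
instance labelingSetoid (p k : ℕ) : Setoid (Labeling p k) where
  r t₁ t₂ := ∃ γ : List (Fin p) → Subgroup.zpowers (finRotate p),
    ∀ s : Skeleton p k, t₁ s = t₂ ⟨twist γ s.1, by rw [length_twist]; exact s.2⟩
  iseqv :=
    { refl := fun t => ⟨fun _ => 1, fun s => by simp [twist_one]⟩
      symm := by
        rintro t₁ t₂ ⟨γ, h⟩
        obtain ⟨δ, hδ⟩ := exists_twist_inverse γ
        exact ⟨δ, fun s => by simp [h, hδ]⟩
      trans := by
        rintro t₁ t₂ t₃ ⟨γ, h⟩ ⟨δ, h'⟩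
        obtain ⟨η, hη⟩ := exists_twist_twist γ δ
        exact ⟨η, fun s => by simp [h, h', hη]⟩ }

/-- The `p^k`-tree functions: the classes of labeling functions. -/
abbrev TreeFun (p k : ℕ) : Type := Quotient (labelingSetoid p k)

/-- The labeling subfunction `q ↦ t(iq)` of `t` rooted at the sequence `i` of length `1`. -/
def child {p k : ℕ} (t : Labeling p (k + 1)) (i : Fin p) : Labeling p k :=
  fun q => t ⟨i :: q.1, Nat.succ_lt_succ q.2⟩

/-- The labeling function `(f_1 ∣ ⋯ ∣ f_p; ε)`. -/
def node {p k : ℕ} (f : Fin p → Labeling p k) (ε : Fin (p + 1)) : Labeling p (k + 1)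
  | ⟨[], _⟩ => ε
  | ⟨i :: q, h⟩ => f i ⟨q, Nat.lt_of_succ_lt_succ h⟩

/-- The label `t(∅)`. -/
def rootLabel {p k : ℕ} (t : Labeling p (k + 1)) : Fin (p + 1) := t ⟨[], Nat.succ_pos k⟩

/-- Admissibility: at every sequence `s`, the `p` tree subfunctions below `s` are admissible, and
they are all equal if `t(s) ∈ [0, p - 1]`, and not all equal if `t(s) = p`. (There are no
subfunctions below a sequence of length `k - 1`, so that its label is not `p`: for `k + 1 = 1` the
labeling functions in `Labeling p 0` are all equal.) -/
def Admissible {p : ℕ} : {k : ℕ} → Labeling p k → Prop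
  | 0, _ => True
  | _ + 1, t => (∀ i, Admissible (child t i)) ∧
      (rootLabel t ≠ Fin.last p → ∀ i j, child t i ≈ child t j) ∧
      (rootLabel t = Fin.last p → ∃ i j, ¬ child t i ≈ child t j)

/-- A tree function is admissible if an admissible labeling function represents it. -/
def TreeFun.IsAdmissible {p k : ℕ} (T : TreeFun p k) : Prop :=
  ∃ t : Labeling p k, ⟦t⟧ = T ∧ Admissible t

/-- The tree function represented by `s ↦ τ (t s)`, where `t` represents `T`. -/
def TreeFun.relabel {p k : ℕ} (τ : Fin (p + 1) → Fin (p + 1)) (T : TreeFun p k) : TreeFun p k :=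
  Quotient.map (fun (t : Labeling p k) (s : Skeleton p k) => τ (t s))
    (by rintro _ _ ⟨γ, h⟩; exact ⟨γ, fun s => congrArg τ (h s)⟩) T

/-! ## The correspondence between characters and tree functions -/

/-- `T` is a tree function of the character `θ` of `P_{p^k}`, by recursion on `k`:
* for `k = 0`, `θ` is the trivial character of the trivial group, and `T` is the empty function;
* if `θ = 𝒳(φ; ε)` with `φ` irreducible and `ε ∈ [0, p - 1]`, then `T = (S ∣ ⋯ ∣ S; ε)`, where
  `S` is a tree function of `φ` (for `P_p` this is the label `ε` of `φ_ε`);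
* if `θ` is induced from `θ_1 × ⋯ × θ_p` with the `θ_i` irreducible and not all equal, then
  `T = (S_1 ∣ ⋯ ∣ S_p; p)`, where `S_i` is a tree function of `θ_i`. -/
def IsTreeFunOf {p : ℕ} : (k : ℕ) → (sylPow p k → ℂ) → TreeFun p k → Prop
  | 0, θ, _ => θ = 1
  | k + 1, θ, T =>
    (∃ (φ : sylPow p k → ℂ) (ε : Fin p) (t : Labeling p k),
      IsIrrChar φ ∧ IsWreathChar θ φ ε ∧ IsTreeFunOf k φ ⟦t⟧ ∧
        T = ⟦node (fun _ => t) ε.castSucc⟧) ∨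
    (∃ (φ : Fin p → sylPow p k → ℂ) (t : Fin p → Labeling p k),
      (∀ i, IsIrrChar (φ i)) ∧ (∃ i j, φ i ≠ φ j) ∧ θ = inducedFromBase φ ∧
        (∀ i, IsTreeFunOf k (φ i) ⟦t i⟧) ∧ T = ⟦node t (Fin.last p)⟧)

namespace PadicExpansion

variable {p n : ℕ} (E : PadicExpansion p n)

/-- The `n`-tree functions `(T_1, …, T_{q_t})`. -/
abbrev NTreeFun : Type := (c : E.Factor) → TreeFun p (E.k c.1)

/-- `θ = ×_c φ_c` as a character of the direct product `P_n` of the groups `P_{p^{k_i}}`. -/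
def IsProductOf (θ : E.sylow → ℂ) (φ : (c : E.Factor) → sylPow p (E.k c.1) → ℂ) : Prop :=
  ∀ x : (c : E.Factor) → sylPow p (E.k c.1), θ (E.blockHom.rangeRestrict x) = ∏ c, φ c (x c)

/-- `T` is an `n`-tree function of the character `θ = ×_c φ_c` of `P_n`: each component `T_c` is
a tree function of `φ_c`. -/
def IsNTreeFunOf (θ : E.sylow → ℂ) (T : E.NTreeFun) : Prop :=
  ∃ φ : (c : E.Factor) → sylPow p (E.k c.1) → ℂ,
    (∀ c, IsIrrChar (φ c)) ∧ E.IsProductOf θ φ ∧ ∀ c, IsTreeFunOf (E.k c.1) (φ c) (T c)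

end PadicExpansion

/-! ## The Galois action -/

/-- The field `ℚ(ω)` with `ω = e ^ {2 π i / p}`. -/
noncomputable abbrev cycField (p : ℕ) : IntermediateField ℚ ℂ :=
  IntermediateField.adjoin ℚ {omega p}

/-- `θ' = θ^σ`: all values of `θ` lie in `ℚ(ω)`, and `θ'(g) = θ(g)^σ` for all `g`. -/
def IsGaloisConj {p : ℕ} {G : Type} (σ : cycField p ≃ₐ[ℚ] cycField p) (θ θ' : G → ℂ) : Prop :=
  ∀ g, ∃ z : cycField p, (z : ℂ) = θ g ∧ ((σ z : cycField p) : ℂ) = θ' g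

/-- The map `τ` on the labels in `[0, p]`: it fixes `p`, and it sends `ε ∈ [0, p - 1]` to the
residue of `b ε` modulo `p`. If `b` is a primitive root modulo `p`, this is the cycle
`(b_1, …, b_{p-1})` with `b_i ≡ b ^ i` modulo `p`. -/
def tau (p : ℕ) [Fact p.Prime] (b : ℕ) (x : Fin (p + 1)) : Fin (p + 1) :=
  if x = Fin.last p then Fin.last p
  else ⟨b * x % p, (Nat.mod_lt _ (Fact.out : p.Prime).pos).trans (Nat.lt_succ_self p)⟩

end SylowTree

/-! The group `P_{p^{k+1}}` is the semidirect product of the base group `B = (P_{p^k})^p` with the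
cyclic group generated by `γ`, and Clifford theory over `B` yields two kinds of irreducible
characters. A product `φ × ⋯ × φ` has the `p` extensions `𝒳(φ; φ_ε)` (`isIrrChar_wreathChar`). A
product with unequal factors has `p` distinct cyclic shifts, because `p` is prime, and therefore
induces irreducibly (`isIrrChar_indFun`); two such products induce the same character exactly when
they are cyclic shifts of each other. Tree functions obey the same recursion: by
`node_equiv_node_iff` a node is determined by its label and by its children up to a cyclic shift.
Induction on `k` then shows that character and tree function determine each other
(`IsTreeFunOf.char_unique`, `IsTreeFunOf.treeFun_unique`).

Completeness of the list needs no count of degrees. The indicator function of the identity pairs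
with an irreducible `ψ` to `ψ(1)/|G| ≠ 0`, so any set of irreducible characters whose span contains
it is the full set (`IsIrrChar.mem_of_unitFun_mem_span`). This indicator is a product on a direct
product, and on the wreath product it is `p⁻¹` times the function induced from `B`;
`unitFun_mem_span_wreathIrr` carries the span condition from `k` to `k + 1`.

For the Galois action, `wreathChar` and `indFun` express the values through sums and products of
values one level lower and powers of `ω`. Applying `σ` to these formulas conjugates the lower
characters and replaces `ω ^ ε` by `ω ^ (b ε)`, which is `τ` on the labels
(`IsTreeFunOf.exists_galoisConj`). The case of `P_n` follows factor by factor. -/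

namespace SylowTree

open Representation

/-! ### Orthogonality, an irreducibility criterion and a completeness criterion -/

section Characters

/-- The character of some finite-dimensional complex matrix representation of `G`. -/
def IsChar {G : Type} [Group G] (χ : G → ℂ) : Prop :=
  ∃ (ι : Type) (_ : Fintype ι) (_ : DecidableEq ι) (ρ : G →* Matrix ι ι ℂ),
    ∀ g, χ g = (ρ g).trace

/-- The bilinear form `|G|⁻¹ ∑_g χ(g) ψ(g⁻¹)` on functions on `G`. -/
noncomputable def charForm {G : Type} [Group G] [Fintype G] (χ ψ : G → ℂ) : ℂ :=
  (Nat.card G : ℂ)⁻¹ * ∑ g, χ g * ψ g⁻¹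

variable {G : Type} [Group G]

theorem isChar_character {d : ℕ} (ρ : Representation ℂ G (Fin d → ℂ)) : IsChar ρ.character :=
  ⟨Fin d, inferInstance, inferInstance,
    { toFun := fun g => LinearMap.toMatrix' (ρ g)
      map_one' := by rw [map_one]; exact LinearMap.toMatrix'_id
      map_mul' := fun g h => by rw [map_mul]; exact LinearMap.toMatrix'_mul _ _ },
    fun g => by
      show LinearMap.trace ℂ _ (ρ g) = _
      rw [LinearMap.trace_eq_matrix_trace ℂ (Pi.basisFun ℂ (Fin d))]
      rfl⟩

theorem IsChar.exists_representation {χ : G → ℂ} (h : IsChar χ) :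
    ∃ (d : ℕ) (ρ : Representation ℂ G (Fin d → ℂ)), ρ.character = χ := by
  obtain ⟨ι, _, _, ρ, hρ⟩ := h
  let e := Fintype.equivFin ι
  refine ⟨Fintype.card ι,
    { toFun := fun g => Matrix.toLin' (Matrix.reindex e e (ρ g))
      map_one' := by simp [Module.End.one_eq_id]
      map_mul' := fun g h => by
        rw [map_mul, Module.End.mul_eq_comp, ← Matrix.toLin'_mul]
        simp [Matrix.submatrix_mul_equiv] }, ?_⟩
  funext g
  show LinearMap.trace ℂ _ (Matrix.toLin' (Matrix.reindex e e (ρ g))) = _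
  rw [Matrix.trace_toLin'_eq, hρ]
  simp only [Matrix.trace, Matrix.diag, Matrix.reindex_apply, Matrix.submatrix_apply]
  exact Equiv.sum_comp e.symm (fun i => ρ g i i)

theorem IsIrrChar.isChar {χ : G → ℂ} (h : IsIrrChar χ) : IsChar χ := by
  obtain ⟨d, ρ, -, rfl⟩ := h
  exact isChar_character ρ

theorem IsChar.conj {χ : G → ℂ} (h : IsChar χ) (g x : G) : χ (x⁻¹ * g * x) = χ g := by
  obtain ⟨ι, _, _, ρ, hρ⟩ := h
  rw [hρ, hρ, map_mul, Matrix.trace_mul_comm, ← map_mul]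
  simp

theorem IsIrrChar.one_ne_zero {χ : G → ℂ} (h : IsIrrChar χ) : χ 1 ≠ 0 := by
  obtain ⟨d, ρ, hρ, rfl⟩ := h
  rw [char_one]
  have : Nontrivial (Fin d → ℂ) := by
    by_contra hn
    rw [not_nontrivial_iff_subsingleton] at hn
    obtain ⟨a, b, hab⟩ := hρ.toNontrivial
    apply hab
    apply SetLike.ext
    intro x
    rw [Subsingleton.elim x 0]
    exact ⟨fun _ => b.toSubmodule.zero_mem, fun _ => a.toSubmodule.zero_mem⟩
  exact_mod_cast (Module.finrank_pos (R := ℂ) (M := Fin d → ℂ)).ne'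

theorem charForm_irr_self [Fintype G] {χ : G → ℂ} (h : IsIrrChar χ) : charForm χ χ = 1 := by
  classical
  obtain ⟨d, ρ, hρ, rfl⟩ := h
  have := invertibleOfNonzero (NeZero.ne (Nat.card G : ℂ))
  rw [charForm, char_orthonormal, if_pos ⟨Representation.Equiv.refl ρ⟩]

theorem charForm_irr_of_ne [Fintype G] {χ ψ : G → ℂ} (h : IsIrrChar χ) (h' : IsIrrChar ψ)
    (hne : χ ≠ ψ) : charForm χ ψ = 0 := by
  classical
  obtain ⟨d, ρ, hρ, rfl⟩ := h
  obtain ⟨d', ρ', hρ', rfl⟩ := h'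
  have := invertibleOfNonzero (NeZero.ne (Nat.card G : ℂ))
  rw [charForm, char_orthonormal, if_neg]
  rintro ⟨φ⟩
  exact hne (char_iso φ).symm

/-- Converse of Schur's lemma: by Maschke's theorem an invariant subspace is the image of an
equivariant projection, which must be a scalar, so the subspace is zero or everything. -/
theorem isIrreducible_of_finrank_eq_one [Finite G] {d : ℕ} (ρ : Representation ℂ G (Fin d → ℂ))
    (h : Module.finrank ℂ (IntertwiningMap ρ ρ) = 1) : ρ.IsIrreducible := by
  have hfin : Module.finrank ℂ (Module.End (MonoidAlgebra ℂ G) ρ.asModule) = 1 := by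
    rw [← h]
    exact (IntertwiningMap.equivLinearMapAsModule ρ ρ).symm.finrank_eq
  have hnt : Nontrivial ρ.asModule := by
    by_contra hn
    rw [not_nontrivial_iff_subsingleton] at hn
    have : Subsingleton (Module.End (MonoidAlgebra ℂ G) ρ.asModule) := inferInstance
    rw [Module.finrank_zero_of_subsingleton] at hfin
    simp at hfin
  rw [irreducible_iff_isSimpleModule_asModule, isSimpleModule_iff]
  refine { eq_bot_or_eq_top := fun P => ?_ }
  obtain ⟨Q, hPQ⟩ := MonoidAlgebra.Submodule.exists_isCompl P
  obtain ⟨c, hc⟩ := (finrank_eq_one_iff_of_nonzero'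
    (1 : Module.End (MonoidAlgebra ℂ G) ρ.asModule) one_ne_zero).mp hfin
      (P.subtype ∘ₗ P.projectionOnto Q hPQ)
  have hcv : ∀ v : ρ.asModule, c • v = P.projectionOnto Q hPQ v := fun v => by
    have := LinearMap.congr_fun hc v
    simpa using this
  by_cases h0 : c = 0
  · left
    rw [Submodule.eq_bot_iff]
    intro v hv
    have := hcv (⟨v, hv⟩ : P)
    rw [Submodule.projectionOnto_apply_left hPQ ⟨v, hv⟩, h0, zero_smul] at this
    exact this.symm
  · right
    rw [Submodule.eq_top_iff']
    intro v
    have h1 : v = c⁻¹ • (c • v) := by rw [smul_smul, inv_mul_cancel₀ h0, one_smul]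
    have h2 : c • v ∈ P := by rw [hcv]; exact Subtype.property _
    -- `P` is a submodule over the group algebra, so the complex scalar is first turned into an
    -- element of that algebra.
    rw [h1, ← algebraMap_smul (MonoidAlgebra ℂ G) c⁻¹ (c • v)]
    exact P.smul_mem _ h2

/-- The form of a character with itself is the dimension of the space of self-intertwiners.
Irreducibility thus becomes a computation with character values. -/
theorem isIrrChar_iff [Fintype G] {χ : G → ℂ} : IsIrrChar χ ↔ IsChar χ ∧ charForm χ χ = 1 := by
  refine ⟨fun h => ⟨h.isChar, charForm_irr_self h⟩, fun ⟨h, h1⟩ => ?_⟩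
  obtain ⟨d, ρ, rfl⟩ := h.exists_representation
  refine ⟨d, ρ, isIrreducible_of_finrank_eq_one ρ ?_, rfl⟩
  have := invertibleOfNonzero (NeZero.ne (Nat.card G : ℂ))
  rw [charForm, card_inv_mul_sum_char_mul_char_eq_finrank] at h1
  exact_mod_cast h1

theorem IsIrrChar.eq_of_charForm_ne_zero [Fintype G] {χ ψ : G → ℂ} (h : IsIrrChar χ)
    (h' : IsIrrChar ψ) (hne : charForm χ ψ ≠ 0) : χ = ψ :=
  not_not.mp fun hn => hne (charForm_irr_of_ne h h' hn)

/-- Pairing the relation with `ψ` gives `a * charForm χ ψ = b`, which is nonzero, so orthogonality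
forces equality. -/
theorem IsIrrChar.eq_of_proportional [Finite G] {χ ψ : G → ℂ} (h : IsIrrChar χ)
    (h' : IsIrrChar ψ) {a b : ℂ} (hb : b ≠ 0) (hab : ∀ g, a * χ g = b * ψ g) :
    χ = ψ := by
  have := Fintype.ofFinite G
  refine h.eq_of_charForm_ne_zero h' fun h0 => hb ?_
  have : a * charForm χ ψ = b * charForm ψ ψ := by
    simp only [charForm, Finset.mul_sum]
    refine Finset.sum_congr rfl fun g _ => ?_
    linear_combination (Nat.card G : ℂ)⁻¹ * ψ g⁻¹ * hab g
  rw [h0, charForm_irr_self h', mul_zero, mul_one] at this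
  exact this.symm

/-- The function with value `1` at the identity and `0` elsewhere. -/
noncomputable def unitFun (G : Type) [Group G] : G → ℂ :=
  open scoped Classical in fun g => if g = 1 then 1 else 0

/-- A set of irreducible characters whose span contains `unitFun G` contains all irreducible
characters. -/
theorem IsIrrChar.mem_of_unitFun_mem_span [Finite G] {S : Set (G → ℂ)}
    (hS : ∀ χ ∈ S, IsIrrChar χ) (hu : unitFun G ∈ Submodule.span ℂ S) {ψ : G → ℂ}
    (hψ : IsIrrChar ψ) : ψ ∈ S := by
  have := Fintype.ofFinite G
  by_contra hn
  have key : ∀ f ∈ Submodule.span ℂ S, charForm f ψ = 0 := by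
    intro f hf
    induction hf using Submodule.span_induction with
    | mem χ hχ => exact charForm_irr_of_ne (hS χ hχ) hψ fun h => hn (h ▸ hχ)
    | zero => simp [charForm]
    | add f g _ _ hf hg =>
      simp only [charForm, Pi.add_apply, add_mul, Finset.sum_add_distrib, mul_add] at *
      rw [hf, hg, add_zero]
    | smul a f _ hf =>
      simp only [charForm, Pi.smul_apply, smul_eq_mul, mul_assoc, ← Finset.mul_sum] at *
      rw [mul_left_comm, hf, mul_zero]
  -- Only the term at the identity survives in this pairing, which leaves `ψ 1` divided by the group
  -- order.
  have h1 := key _ hu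
  classical
  simp only [charForm, unitFun, ite_mul, one_mul, zero_mul, Finset.sum_ite_eq',
    Finset.mem_univ, if_true, inv_one, mul_eq_zero, inv_eq_zero] at h1
  rcases h1 with h1 | h1
  · exact NeZero.ne _ h1
  · exact hψ.one_ne_zero h1

/-- `unitFun G` is a combination of irreducible characters. -/
def UnitFunSpanned (G : Type) [Group G] : Prop :=
  unitFun G ∈ Submodule.span ℂ {χ : G → ℂ | IsIrrChar χ}

theorem UnitFunSpanned.exists_sum (h : UnitFunSpanned G) :
    ∃ (m : ℕ) (a : Fin m → ℂ) (χ : Fin m → G → ℂ), (∀ i, IsIrrChar (χ i)) ∧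
      ∀ g, unitFun G g = ∑ i, a i * χ i g := by
  obtain ⟨m, a, χ, h⟩ := Submodule.mem_span_set'.mp h
  refine ⟨m, a, fun i => χ i, fun i => (χ i).2, fun g => ?_⟩
  rw [← h]
  simp

theorem isIrrChar_comp_mulEquiv {G' : Type} [Group G'] (e : G' ≃* G) {χ : G → ℂ} :
    IsIrrChar χ → IsIrrChar (χ ∘ e) := by
  rintro ⟨d, ρ, hρ, rfl⟩
  refine ⟨d, ρ.comp e.toMonoidHom, ?_, rfl⟩
  let o : Subrepresentation ρ ≃o Subrepresentation (ρ.comp e.toMonoidHom) :=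
    { toFun := fun W => ⟨W.toSubmodule, fun g v hv => W.apply_mem_toSubmodule (e g) hv⟩
      invFun := fun W => ⟨W.toSubmodule, fun g v hv => by
        have := W.apply_mem_toSubmodule (e.symm g) hv
        simpa using this⟩
      left_inv := fun _ => rfl
      right_inv := fun _ => rfl
      map_rel_iff' := Iff.rfl }
  exact (OrderIso.isSimpleOrder_iff o).mp hρ

end Characters

/-! ### Irreducible characters of finite direct products -/

section Products

variable {C : Type} [Fintype C] {G : C → Type} [∀ c, Group (G c)]

/-- The external product of functions. -/
def prodFun (χ : (c : C) → G c → ℂ) (x : (c : C) → G c) : ℂ := ∏ c, χ c (x c)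

theorem sum_prod_entries {ι : C → Type} [∀ c, Fintype (ι c)] [DecidableEq C]
    (A B : (c : C) → Matrix (ι c) (ι c) ℂ) (x z : (c : C) → ι c) :
    ∑ y : (c : C) → ι c, (∏ c, A c (x c) (y c)) * ∏ c, B c (y c) (z c) =
      ∏ c, (A c * B c) (x c) (z c) := by
  simp only [Matrix.mul_apply, ← Finset.prod_mul_distrib, Finset.prod_univ_sum,
    Fintype.piFinset_univ]

/-- The external tensor product of matrix representations. -/
noncomputable def piKronecker [DecidableEq C] {ι : C → Type} [∀ c, Fintype (ι c)]
    [∀ c, DecidableEq (ι c)]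
    (ρ : (c : C) → G c →* Matrix (ι c) (ι c) ℂ) :
    ((c : C) → G c) →* Matrix ((c : C) → ι c) ((c : C) → ι c) ℂ where
  toFun x := Matrix.of fun a b => ∏ c, ρ c (x c) (a c) (b c)
  map_one' := by
    ext a b
    simp only [Pi.one_apply, map_one, Matrix.of_apply, Matrix.one_apply, Finset.prod_ite_zero,
      Finset.prod_const_one, funext_iff, Finset.mem_univ, true_imp_iff]
  map_mul' x y := by
    ext a b
    simp only [Pi.mul_apply, map_mul, Matrix.of_apply, Matrix.mul_apply', dotProduct]
    rw [sum_prod_entries]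
    rfl

theorem trace_piKronecker [DecidableEq C] {ι : C → Type} [∀ c, Fintype (ι c)]
    [∀ c, DecidableEq (ι c)] (ρ : (c : C) → G c →* Matrix (ι c) (ι c) ℂ) (x : (c : C) → G c) :
    (piKronecker ρ x).trace = ∏ c, (ρ c (x c)).trace := by
  simp only [Matrix.trace, Matrix.diag, Finset.prod_univ_sum, Fintype.piFinset_univ]
  rfl

/-- The tensor product has the functions `c ↦ ι c` as its natural basis; allowing arbitrary finite
index types in `IsChar` avoids numbering them. -/
theorem isChar_prodFun {χ : (c : C) → G c → ℂ} (h : ∀ c, IsChar (χ c)) : IsChar (prodFun χ) := by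
  classical
  choose ι h1 h2 ρ hρ using h
  exact ⟨_, inferInstance, inferInstance, piKronecker ρ, fun x => by
    rw [trace_piKronecker, prodFun]
    exact Finset.prod_congr rfl fun c _ => hρ c _⟩

theorem charForm_prodFun [DecidableEq C] [∀ c, Fintype (G c)] (χ ψ : (c : C) → G c → ℂ) :
    charForm (prodFun χ) (prodFun ψ) = ∏ c, charForm (χ c) (ψ c) := by
  simp only [charForm, prodFun, ← Finset.prod_mul_distrib, Pi.inv_apply, Nat.card_pi,
    Nat.cast_prod]
  rw [← Finset.prod_inv_distrib, Finset.prod_mul_distrib, Finset.prod_univ_sum,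
    Fintype.piFinset_univ]

theorem isIrrChar_prodFun [∀ c, Finite (G c)] {χ : (c : C) → G c → ℂ}
    (h : ∀ c, IsIrrChar (χ c)) : IsIrrChar (prodFun χ) := by
  classical
  have := fun c => Fintype.ofFinite (G c)
  rw [isIrrChar_iff]
  refine ⟨isChar_prodFun fun c => (h c).isChar, ?_⟩
  rw [charForm_prodFun]
  exact Finset.prod_eq_one fun c _ => charForm_irr_self (h c)

/-- Restricting to a single factor recovers that component up to a nonzero constant, the product of
the other degrees; proportional irreducible characters are equal. -/
theorem prodFun_injective [∀ c, Finite (G c)] {χ ψ : (c : C) → G c → ℂ}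
    (h : ∀ c, IsIrrChar (χ c)) (h' : ∀ c, IsIrrChar (ψ c)) (heq : prodFun χ = prodFun ψ) :
    χ = ψ := by
  classical
  funext c
  refine (h c).eq_of_proportional (h' c)
    (a := ∏ i ∈ Finset.univ.erase c, χ i 1) (b := ∏ i ∈ Finset.univ.erase c, ψ i 1)
    (Finset.prod_ne_zero_iff.mpr fun i _ => (h' i).one_ne_zero) fun g => ?_
  have := congrFun heq (Pi.mulSingle c g)
  rw [prodFun, prodFun, ← Finset.prod_erase_mul _ _ (Finset.mem_univ c),
    ← Finset.prod_erase_mul _ _ (Finset.mem_univ c), Pi.mulSingle_eq_same] at this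
  convert this using 2 <;>
  · refine Finset.prod_congr rfl fun i hi => ?_
    rw [Pi.mulSingle_eq_of_ne (Finset.ne_of_mem_erase hi)]

theorem unitFun_pi (x : (c : C) → G c) : unitFun ((c : C) → G c) x = ∏ c, unitFun (G c) (x c) := by
  classical
  simp only [unitFun, Finset.prod_ite_zero, Finset.prod_const_one, funext_iff, Finset.mem_univ,
    true_imp_iff, Pi.one_apply]

/-- The indicator of the identity is the product of the indicators of the factors; multiplying out
their expansions gives a combination of products of irreducible characters. -/
theorem unitFun_pi_mem_span (h : ∀ c, UnitFunSpanned (G c)) :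
    unitFun ((c : C) → G c) ∈ Submodule.span ℂ
      {θ | ∃ χ : (c : C) → G c → ℂ, (∀ c, IsIrrChar (χ c)) ∧ prodFun χ = θ} := by
  classical
  choose m a χ hχ hu using fun c => (h c).exists_sum
  have : unitFun ((c : C) → G c) = ∑ j : (c : C) → Fin (m c),
      (∏ c, a c (j c)) • prodFun fun c => χ c (j c) := by
    funext x
    simp only [unitFun_pi, hu, Finset.prod_univ_sum, Fintype.piFinset_univ, Finset.sum_apply,
      Pi.smul_apply, smul_eq_mul, prodFun, Finset.prod_mul_distrib]
  rw [this]
  exact Submodule.sum_mem _ fun j _ => Submodule.smul_mem _ _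
    (Submodule.subset_span ⟨_, fun c => hχ c (j c), rfl⟩)

theorem IsIrrChar.exists_eq_prodFun [∀ c, Finite (G c)] (h : ∀ c, UnitFunSpanned (G c))
    {θ : ((c : C) → G c) → ℂ} (hθ : IsIrrChar θ) :
    ∃ χ : (c : C) → G c → ℂ, (∀ c, IsIrrChar (χ c)) ∧ prodFun χ = θ := by
  refine hθ.mem_of_unitFun_mem_span ?_ (unitFun_pi_mem_span h)
  rintro _ ⟨χ, hχ, rfl⟩
  exact isIrrChar_prodFun hχ

end Products

/-! ### Coordinates `(f; γ ^ s)` on the wreath product -/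

section Coordinates

variable {p k : ℕ}

theorem finRotate_pow_apply [NeZero p] (s : ℕ) (i : Fin p) :
    (finRotate p ^ s) i = i + Fin.ofNat p s := by
  obtain ⟨m, rfl⟩ := Nat.exists_eq_succ_of_ne_zero (NeZero.ne p)
  induction s with
  | zero => ext; simp
  | succ s ih =>
    rw [pow_succ', Perm.mul_apply, ih, finRotate_apply]
    ext
    simp [Fin.val_add, Nat.add_assoc]

theorem finRotate_pow_inv_apply [NeZero p] (s : ℕ) (i : Fin p) :
    (finRotate p ^ s)⁻¹ i = i - Fin.ofNat p s := by
  rw [Perm.inv_eq_iff_eq, finRotate_pow_apply, sub_add_cancel]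

theorem finRotate_pow_eq_iff [NeZero p] (s t : ℕ) :
    finRotate p ^ s = finRotate p ^ t ↔ Fin.ofNat p s = Fin.ofNat p t := by
  refine ⟨fun h => ?_, fun h => ?_⟩
  · have := Equiv.congr_fun h 0
    simpa only [finRotate_pow_apply, zero_add] using this
  · ext1 i
    rw [finRotate_pow_apply, finRotate_pow_apply, h]

theorem mem_zpowers_finRotate_iff [NeZero p] (δ : Perm (Fin p)) :
    δ ∈ Subgroup.zpowers (finRotate p) ↔ ∃ r : Fin p, ∀ i, δ i = i + r := by
  refine ⟨fun h => ?_, fun ⟨r, hr⟩ => ?_⟩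
  · obtain ⟨s, rfl⟩ := mem_powers_iff_mem_zpowers.mpr h
    exact ⟨Fin.ofNat p s, finRotate_pow_apply s⟩
  · have : δ = finRotate p ^ (r : ℕ) := by
      ext1 i
      rw [hr, finRotate_pow_apply, Fin.ofNat_val_eq_self]
    rw [this]
    exact Subgroup.npow_mem_zpowers _ _

theorem wreathPerm_injective [NeZero p] {f g : Fin p → Perm (Fin (p ^ k))} {δ η : Perm (Fin p)}
    (h : wreathPerm f δ = wreathPerm g η) : f = g ∧ δ = η := by
  have h1 : wreathAct f δ = wreathAct g η := (blockEquiv p k).permCongrHom.injective h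
  have h2 : δ = η := by
    ext1 i
    -- Every block has a point, since `p ^ k > 0`, so the permutation of the blocks can be read off.
    have := Equiv.congr_fun h1 (i, (⟨0, pow_pos (Nat.pos_of_ne_zero (NeZero.ne p)) k⟩ : Fin _))
    exact (Prod.ext_iff.mp this).1
  subst h2
  refine ⟨?_, rfl⟩
  funext i
  ext1 x
  have := Equiv.congr_fun h1 (δ⁻¹ i, x)
  simpa [wreathAct] using (Prod.ext_iff.mp this).2

theorem wreathElt_eq_iff [NeZero p] {f g : Fin p → sylPow p k} {s t : ℕ} :
    wreathElt f s = wreathElt g t ↔ f = g ∧ Fin.ofNat p s = Fin.ofNat p t := by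
  rw [← finRotate_pow_eq_iff]
  refine ⟨fun h => ?_, fun ⟨h1, h2⟩ => ?_⟩
  · obtain ⟨h1, h2⟩ := wreathPerm_injective (congrArg Subtype.val h)
    refine ⟨?_, h2⟩
    funext i
    exact Subtype.ext (congrFun h1 i)
  · subst h1
    exact Subtype.ext (congrArg (wreathPerm _) h2)

theorem wreathElt_surjective [NeZero p] (g : sylPow p (k + 1)) :
    ∃ (f : Fin p → sylPow p k) (s : Fin p), wreathElt f s = g := by
  obtain ⟨g, f, δ, hδ, hf, rfl⟩ := g
  obtain ⟨s, rfl⟩ := mem_powers_iff_mem_zpowers.mpr hδ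
  refine ⟨fun i => ⟨f i, hf i⟩, Fin.ofNat p s, Subtype.ext ?_⟩
  refine congrArg (wreathPerm f) ?_
  rw [finRotate_pow_eq_iff, Fin.ofNat_val_eq_self]

/-- The coordinates `(f, s)` of the element `(f; γ ^ s)` of `P_{p^{k+1}}`. -/
noncomputable def wreathEquiv (p k : ℕ) [NeZero p] :
    (Fin p → sylPow p k) × Fin p ≃ sylPow p (k + 1) :=
  Equiv.ofBijective (fun x => wreathElt x.1 x.2)
    ⟨fun x y h => by
      obtain ⟨h1, h2⟩ := wreathElt_eq_iff.mp h
      rw [Fin.ofNat_val_eq_self, Fin.ofNat_val_eq_self] at h2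
      exact Prod.ext h1 h2,
    fun g => by
      obtain ⟨f, s, h⟩ := wreathElt_surjective g
      exact ⟨(f, s), h⟩⟩

variable [NeZero p]

/-- The component of an element of `P_{p^{k+1}}` in the base group. -/
noncomputable def base (g : sylPow p (k + 1)) : Fin p → sylPow p k := ((wreathEquiv p k).symm g).1

/-- The exponent `s` of the component `γ ^ s` of an element of `P_{p^{k+1}}`. -/
noncomputable def top (g : sylPow p (k + 1)) : Fin p := ((wreathEquiv p k).symm g).2

theorem wreathElt_base_top (g : sylPow p (k + 1)) : wreathElt (base g) (top g) = g :=
  (wreathEquiv p k).apply_symm_apply g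

@[simp] theorem base_wreathElt (f : Fin p → sylPow p k) (s : ℕ) : base (wreathElt f s) = f :=
  (wreathElt_eq_iff.mp (wreathElt_base_top (wreathElt f s))).1

@[simp] theorem top_wreathElt (f : Fin p → sylPow p k) (s : ℕ) :
    top (wreathElt f s) = Fin.ofNat p s := by
  rw [← (wreathElt_eq_iff.mp (wreathElt_base_top (wreathElt f s))).2, Fin.ofNat_val_eq_self]

theorem wreath_ext {g h : sylPow p (k + 1)} (h1 : base g = base h) (h2 : top g = top h) :
    g = h := by
  rw [← wreathElt_base_top g, ← wreathElt_base_top h, h1, h2]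

theorem wreathElt_mul (f g : Fin p → sylPow p k) (s t : ℕ) :
    wreathElt f s * wreathElt g t = wreathElt (fun i => f i * g (i - Fin.ofNat p s)) (s + t) := by
  apply Subtype.ext
  simp only [wreathElt, Subgroup.coe_mul, wreathPerm_mul, finRotate_pow_inv_apply, pow_add]

theorem base_mul (g h : sylPow p (k + 1)) (i : Fin p) :
    base (g * h) i = base g i * base h (i - top g) := by
  conv_lhs => rw [← wreathElt_base_top g, ← wreathElt_base_top h, wreathElt_mul, base_wreathElt,
    Fin.ofNat_val_eq_self]

@[simp] theorem top_mul (g h : sylPow p (k + 1)) : top (g * h) = top g + top h := by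
  conv_lhs => rw [← wreathElt_base_top g, ← wreathElt_base_top h, wreathElt_mul, top_wreathElt]
  ext
  simp [Fin.val_add]

@[simp] theorem top_one : top (1 : sylPow p (k + 1)) = 0 := by
  have := top_mul (1 : sylPow p (k + 1)) 1
  rwa [mul_one, left_eq_add] at this

@[simp] theorem base_one : base (1 : sylPow p (k + 1)) = 1 := by
  funext i
  have := base_mul (1 : sylPow p (k + 1)) 1 i
  rwa [mul_one, top_one, sub_zero, left_eq_mul] at this

@[simp] theorem top_inv (g : sylPow p (k + 1)) : top g⁻¹ = -top g := by
  rw [eq_neg_iff_add_eq_zero, ← top_mul, inv_mul_cancel, top_one]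

theorem base_inv (g : sylPow p (k + 1)) (i : Fin p) : base g⁻¹ i = (base g (i + top g))⁻¹ := by
  rw [eq_inv_iff_mul_eq_one]
  have := base_mul g⁻¹ g i
  rwa [inv_mul_cancel, base_one, top_inv, sub_neg_eq_add, Pi.one_apply, eq_comm] at this

@[simp] theorem base_baseHom (f : Fin p → sylPow p k) : base (baseHom p k f) = f :=
  base_wreathElt f 0

@[simp] theorem top_baseHom (f : Fin p → sylPow p k) : top (baseHom p k f) = 0 :=
  top_wreathElt f 0

theorem sum_wreath [Fintype (sylPow p k)] [Fintype (sylPow p (k + 1))]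
    (F : sylPow p (k + 1) → ℂ) : ∑ g, F g = ∑ r : Fin p, ∑ f, F (wreathElt f r) := by
  rw [← Equiv.sum_comp (wreathEquiv p k), Fintype.sum_prod_type_right]
  rfl

variable (p k) in
theorem card_sylPow_succ :
    Nat.card (sylPow p (k + 1)) = Nat.card (Fin p → sylPow p k) * p := by
  rw [← Nat.card_congr (wreathEquiv p k), Nat.card_prod, Nat.card_fin]

end Coordinates

/-! ### Closed path sums and traces of cyclic products -/

section CyclicTrace

open scoped Fin.CommRing

/-- An entry of a matrix product is a sum over paths from `a` to `b`. The interior vertices are `y`;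
`Fin.cons a y` lists the starting points of the steps and `Fin.snoc y b` their endpoints. -/
theorem list_prod_apply_eq_sum {ι : Type} [Fintype ι] [DecidableEq ι] (m : ℕ)
    (B : Fin (m + 1) → Matrix ι ι ℂ) (a b : ι) :
    (List.ofFn B).prod a b = ∑ y : Fin m → ι, ∏ j,
      B j ((Fin.cons a y : Fin (m + 1) → ι) j) ((Fin.snoc y b : Fin (m + 1) → ι) j) := by
  induction m generalizing a with
  | zero => simp [Fin.snoc]
  | succ m ih =>
    rw [List.ofFn_succ, List.prod_cons, Matrix.mul_apply, ← (Fin.consEquiv fun _ => ι).sum_comp,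
      Fintype.sum_prod_type]
    refine Finset.sum_congr rfl fun c _ => ?_
    rw [ih, Finset.mul_sum]
    refine Finset.sum_congr rfl fun y _ => ?_
    have hc : (Fin.consEquiv fun _ => ι) (c, y) = (Fin.cons c y : Fin (m + 1) → ι) := rfl
    rw [Fin.prod_univ_succ (n := m + 1), hc, ← Fin.cons_snoc_eq_snoc_cons]
    simp only [Fin.cons_zero, Fin.cons_succ]

theorem sum_prod_cyclic {ι : Type} [Fintype ι] [DecidableEq ι] {p : ℕ} [NeZero p]
    (B : Fin p → Matrix ι ι ℂ) :
    ∑ x : Fin p → ι, ∏ j, B j (x j) (x (j + 1)) = (List.ofFn B).prod.trace := by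
  obtain ⟨m, rfl⟩ := Nat.exists_eq_succ_of_ne_zero (NeZero.ne p)
  simp only [Matrix.trace, Matrix.diag, list_prod_apply_eq_sum]
  rw [← (Fin.consEquiv fun _ => ι).sum_comp, Fintype.sum_prod_type]
  refine Finset.sum_congr rfl fun a _ => Finset.sum_congr rfl fun y _ =>
    Finset.prod_congr rfl fun j _ => ?_
  congr 1
  simp only [Fin.consEquiv_apply]
  refine Fin.lastCases ?_ (fun j => ?_) j
  · simp
  · rw [Fin.snoc_castSucc, Fin.coeSucc_eq_succ, Fin.cons_succ]

/-- The product of the `f i` in the cyclic order `0, -s, -2s, …`. -/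
def cyc {p : ℕ} {H : Type} [Monoid H] (f : Fin p → H) (s : Fin p) : H :=
  (List.ofFn fun j : Fin p => f (-(j * s))).prod

theorem map_cyc {p : ℕ} {H M : Type} [Monoid H] [Monoid M] (φ : H →* M) (f : Fin p → H) (s : Fin p) :
    φ (cyc f s) = cyc (fun i => φ (f i)) s := by
  rw [cyc, map_list_prod, List.map_ofFn]
  rfl

theorem cyc_one {p : ℕ} {H : Type} [Monoid H] (s : Fin p) : cyc (1 : Fin p → H) s = 1 := by
  rw [cyc, List.prod_eq_one]
  intro x hx
  obtain ⟨j, rfl⟩ := List.mem_ofFn.mp hx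
  rfl

variable {p : ℕ} [Fact p.Prime]

theorem mul_right_injective_fin {s : Fin p} (hs : s ≠ 0) :
    Function.Injective fun j : Fin p => -(j * s) := by
  intro i j hij
  have h1 : i * s = j * s := neg_injective hij
  have h2 : (i : ℕ) * s ≡ j * s [MOD p] := by
    have := congrArg Fin.val h1
    rwa [Fin.val_mul, Fin.val_mul] at this
  have hcop : Nat.gcd p s = 1 := by
    refine (Nat.Prime.coprime_iff_not_dvd Fact.out).mpr fun hd => hs ?_
    exact Fin.ext (Nat.eq_zero_of_dvd_of_lt hd s.2)
  have h3 := Nat.ModEq.cancel_right_of_coprime hcop h2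
  exact Fin.ext (Nat.ModEq.eq_of_lt_of_lt h3 i.2 j.2)

/-- A shift by `s ≠ 0` is a single `p`-cycle because `p` is prime, so the factors link up into one
closed path `0, -s, -2s, …`. For `s = 0` each index is linked only to itself and the traces
separate. -/
theorem sum_prod_shift {ι : Type} [Fintype ι] [DecidableEq ι] (A : Fin p → Matrix ι ι ℂ)
    (s : Fin p) : ∑ x : Fin p → ι, ∏ i, A i (x i) (x (i - s)) =
      if s = 0 then ∏ i, (A i).trace else (cyc A s).trace := by
  split_ifs with hs
  · simp only [hs, sub_zero, Matrix.trace, Matrix.diag, Finset.prod_univ_sum,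
      Fintype.piFinset_univ]
  · let e : Perm (Fin p) := Equiv.ofBijective _
      (Finite.injective_iff_bijective.mp (mul_right_injective_fin hs))
    rw [cyc, ← sum_prod_cyclic, ← (e.arrowCongr (Equiv.refl ι)).sum_comp]
    refine Finset.sum_congr rfl fun x _ => ?_
    rw [← Equiv.prod_comp e]
    refine Finset.prod_congr rfl fun j _ => ?_
    -- In the order given by `e j = -(j * s)`, the shift by `-s` is the passage to the next
    -- position.
    have h1 : e j - s = e (j + 1) := by
      simp only [e, Equiv.ofBijective_apply]
      ring
    rw [h1]
    simp only [Equiv.arrowCongr_apply, Function.comp_apply, Equiv.symm_apply_apply,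
      Equiv.refl_apply]
    rfl

end CyclicTrace

/-! ### The trace on a tensor power in the basis of pure tensors -/

section TensorTrace

theorem trace_tensorAct {p d : ℕ} (A : Fin p → (Fin d → ℂ) →ₗ[ℂ] (Fin d → ℂ))
    (δ : Perm (Fin p)) : LinearMap.trace ℂ _ (tensorAct A δ) =
      ∑ x : Fin p → Fin d, ∏ i, LinearMap.toMatrix' (A i) (x i) (x (δ⁻¹ i)) := by
  classical
  let b := Basis.piTensorProduct fun _ : Fin p => Pi.basisFun ℂ (Fin d)
  rw [LinearMap.trace_eq_matrix_trace ℂ b, Matrix.trace]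
  refine Finset.sum_congr rfl fun x _ => ?_
  rw [Matrix.diag, LinearMap.toMatrix_apply]
  simp only [b, Basis.piTensorProduct_apply, tensorAct, LinearMap.comp_apply,
    LinearEquiv.coe_coe]
  rw [PiTensorProduct.reindex_tprod, PiTensorProduct.map_tprod,
    Basis.piTensorProduct_repr_tprod_apply]
  simp [LinearMap.toMatrix'_apply]

end TensorTrace

/-- A subspace invariant under `G` is invariant under `H`, so irreducibility after pulling back
along `f` suffices. Since `hf` concerns only the character, it is transferred to the pulled back `ρ`
by the dimension of its self-intertwiners. -/
theorem isIrrChar_of_comp {H G : Type} [Group H] [Group G] [Finite H] (f : H →* G) {χ : G → ℂ}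
    (h : IsChar χ) (hf : IsIrrChar (χ ∘ f)) : IsIrrChar χ := by
  have := Fintype.ofFinite H
  obtain ⟨d, ρ, rfl⟩ := h.exists_representation
  have h1 := charForm_irr_self hf
  have hirr : Representation.IsIrreducible (ρ.comp f : Representation ℂ H (Fin d → ℂ)) := by
    apply isIrreducible_of_finrank_eq_one
    have := invertibleOfNonzero (NeZero.ne (Nat.card H : ℂ))
    have h2 := Representation.card_inv_mul_sum_char_mul_char_eq_finrank
      (ρ.comp f : Representation ℂ H (Fin d → ℂ)) (ρ.comp f)
    have h3 := h2.symm.trans h1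
    exact_mod_cast h3
  refine ⟨d, ρ, ?_, rfl⟩
  let r : Subrepresentation ρ →
      Subrepresentation (ρ.comp f : Representation ℂ H (Fin d → ℂ)) :=
    fun W => ⟨W.toSubmodule, fun g v hv => W.apply_mem_toSubmodule (f g) hv⟩
  have hr : Function.Injective r := fun W W' h =>
    Subrepresentation.toSubmodule_injective
      (Subrepresentation.mk.inj h)
  refine { exists_pair_ne := ⟨⊥, ⊤, fun h => ?_⟩, eq_bot_or_eq_top := fun W => ?_ }
  · exact bot_ne_top (congrArg r h)
  · exact (hirr.eq_bot_or_eq_top (r W)).imp (fun h => hr h) fun h => hr h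

/-! ### The irreducible characters of `P_{p^{k+1}}` -/

section WreathCharacters

variable {p k : ℕ} [Fact p.Prime]

theorem isPrimitiveRoot_omega (p : ℕ) [Fact p.Prime] : IsPrimitiveRoot (omega p) p :=
  Complex.isPrimitiveRoot_exp p (NeZero.ne p)

theorem omega_pow_pow_mod (ε s : ℕ) :
    (omega p ^ ε) ^ (s % p) = (omega p ^ ε) ^ s := by
  have h : (omega p ^ ε) ^ p = 1 := by
    rw [← pow_mul, mul_comm, pow_mul, (isPrimitiveRoot_omega p).pow_eq_one, one_pow]
  conv_rhs => rw [← Nat.div_add_mod s p, pow_add, pow_mul, h, one_pow, one_mul]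

theorem omega_pow_val_add (ε : ℕ) (s t : Fin p) :
    (omega p ^ ε) ^ ((s + t : Fin p) : ℕ) = (omega p ^ ε) ^ (s : ℕ) * (omega p ^ ε) ^ (t : ℕ) := by
  rw [← pow_add, Fin.val_add, omega_pow_pow_mod]

/-- The values of the character `𝒳(φ; φ_ε)`. -/
noncomputable def wreathChar (φ : sylPow p k → ℂ) (ε : ℕ) (g : sylPow p (k + 1)) : ℂ :=
  (if top g = 0 then ∏ i, φ (base g i) else φ (cyc (base g) (top g))) *
    (omega p ^ ε) ^ (top g : ℕ)

theorem sum_prod_representation {ι : Type} [Fintype ι] [DecidableEq ι]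
    (ρ : sylPow p k →* Matrix ι ι ℂ) (f : Fin p → sylPow p k) (s : Fin p) :
    ∑ x : Fin p → ι, ∏ i, ρ (f i) (x i) (x (i - s)) =
      if s = 0 then ∏ i, (ρ (f i)).trace else (ρ (cyc f s)).trace := by
  rw [sum_prod_shift (fun i => ρ (f i)) s, map_cyc]

/-- The trace on the tensor power depends on the representation only through its character, so the
choice of `ρ` in the definition is immaterial. -/
theorem isWreathChar_iff {θ : sylPow p (k + 1) → ℂ} {φ : sylPow p k → ℂ} {ε : ℕ}
    (hφ : IsIrrChar φ) : IsWreathChar θ φ ε ↔ θ = wreathChar φ ε := by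
  have key : ∀ (d : ℕ) (ρ : Representation ℂ (sylPow p k) (Fin d → ℂ)), ρ.character = φ →
      ∀ (f : Fin p → sylPow p k) (s : ℕ),
        LinearMap.trace ℂ _ (tensorAct (fun i => ρ (f i)) (finRotate p ^ s)) *
          (omega p ^ ε) ^ s = wreathChar φ ε (wreathElt f s) := by
    rintro d ρ rfl f s
    let ρ' : sylPow p k →* Matrix (Fin d) (Fin d) ℂ :=
      { toFun := fun g => LinearMap.toMatrix' (ρ g)
        map_one' := by rw [map_one]; exact LinearMap.toMatrix'_id
        map_mul' := fun g h => by rw [map_mul]; exact LinearMap.toMatrix'_mul _ _ }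
    have htr : ∀ g, (ρ' g).trace = ρ.character g := fun g => by
      show _ = LinearMap.trace ℂ _ (ρ g)
      rw [LinearMap.trace_eq_matrix_trace ℂ (Pi.basisFun ℂ (Fin d))]
      rfl
    have h1 := sum_prod_representation ρ' f (Fin.ofNat p s)
    simp only [htr] at h1
    rw [trace_tensorAct, wreathChar, base_wreathElt, top_wreathElt, ← h1]
    simp only [finRotate_pow_inv_apply, Fin.val_ofNat, omega_pow_pow_mod]
    rfl
  refine ⟨fun ⟨d, ρ, hρ, h⟩ => ?_, fun h => ?_⟩
  · funext g
    rw [← wreathElt_base_top g, h, key d ρ hρ]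
  · obtain ⟨d, ρ, -, hρ⟩ := hφ
    exact ⟨d, ρ, hρ, fun f s => by rw [h, key d ρ hρ]⟩

theorem isChar_wreathChar {φ : sylPow p k → ℂ} (hφ : IsChar φ) (ε : ℕ) :
    IsChar (wreathChar φ ε) := by
  obtain ⟨ι, _, _, ρ, hρ⟩ := hφ
  refine ⟨Fin p → ι, inferInstance, inferInstance,
    { toFun := fun g => Matrix.of fun x y =>
        (∏ i, ρ (base g i) (x i) (y (i - top g))) * (omega p ^ ε) ^ (top g : ℕ)
      map_one' := ?_
      map_mul' := fun g h => ?_ }, fun g => ?_⟩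
  · ext x y
    simp [Matrix.one_apply, Finset.prod_ite_zero, funext_iff]
  · ext x z
    rw [Matrix.mul_apply]
    simp only [Matrix.of_apply, top_mul, base_mul, map_mul, omega_pow_val_add]
    have h1 : ∀ y : Fin p → ι, ∏ i, ρ (base h i) (y i) (z (i - top h)) =
        ∏ i, ρ (base h (i - top g)) (y (i - top g)) (z (i - top g - top h)) := fun y =>
      (Equiv.prod_comp (Equiv.subRight (top g)) fun i => ρ (base h i) (y i) (z (i - top h))).symm
    have h2 := sum_prod_entries (fun i => ρ (base g i)) (fun i => ρ (base h (i - top g))) x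
      (fun i => z (i - top g - top h))
    -- The intermediate index is shifted by `top g`, since `g` moves the tensor positions before the
    -- entries of `h` are read.
    rw [← ((Equiv.subRight (top g)).symm.arrowCongr (Equiv.refl ι)).sum_comp] at h2
    simp only [sub_sub] at h1 h2
    rw [← h2, Finset.sum_mul]
    refine Finset.sum_congr rfl fun y _ => ?_
    rw [h1]
    simp only [Equiv.arrowCongr_apply, Function.comp_apply, Equiv.refl_apply, Equiv.symm_symm,
      Equiv.subRight_apply]
    ring
  · have := sum_prod_representation ρ (base g) (top g)
    simp only [← hρ] at this
    rw [wreathChar, ← this, Finset.sum_mul]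
    rfl

theorem wreathChar_comp_baseHom (φ : sylPow p k → ℂ) (ε : ℕ) :
    wreathChar φ ε ∘ baseHom p k = prodFun fun _ => φ := by
  funext f
  simp [wreathChar, prodFun]

theorem isIrrChar_wreathChar {φ : sylPow p k → ℂ} (hφ : IsIrrChar φ) (ε : ℕ) :
    IsIrrChar (wreathChar φ ε) := by
  refine isIrrChar_of_comp (baseHom p k) (isChar_wreathChar hφ.isChar ε) ?_
  rw [wreathChar_comp_baseHom]
  exact isIrrChar_prodFun fun _ => hφ

/-- At `γ` itself the value is nonzero and reveals `ε`. This separates the `p` extensions of one `φ`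
from each other, and all of them from induced characters, which vanish off the base group. -/
theorem wreathChar_rotation (φ : sylPow p k → ℂ) (ε : ℕ) :
    wreathChar φ ε (wreathElt 1 1) = φ 1 * omega p ^ ε := by
  have hp : 1 < p := (Fact.out : p.Prime).one_lt
  have h0 : Fin.ofNat p 1 ≠ 0 := by
    intro h
    have := congrArg Fin.val h
    simp [Nat.mod_eq_of_lt hp] at this
  rw [wreathChar, base_wreathElt, top_wreathElt, if_neg h0, cyc_one, Fin.val_ofNat,
    omega_pow_pow_mod, pow_one]

theorem wreathChar_injective {φ φ' : sylPow p k → ℂ} (hφ : IsIrrChar φ) (hφ' : IsIrrChar φ')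
    {ε ε' : Fin p} (h : wreathChar φ ε = wreathChar φ' ε') : φ = φ' ∧ ε = ε' := by
  have h1 : φ = φ' := by
    have h2 := congrArg (· ∘ baseHom p k) h
    simp only [wreathChar_comp_baseHom] at h2
    exact congrFun (prodFun_injective (fun _ => hφ) (fun _ => hφ') h2) 0
  subst h1
  refine ⟨rfl, ?_⟩
  have h2 := congrFun h (wreathElt 1 1)
  rw [wreathChar_rotation, wreathChar_rotation] at h2
  exact Fin.ext ((isPrimitiveRoot_omega p).pow_inj ε.2 ε'.2 (mul_left_cancel₀ hφ.one_ne_zero h2))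

/-- Induction of (class) functions from the base group to `P_{p^{k+1}}`. -/
noncomputable def indFun (p k : ℕ) [Fact p.Prime] :
    ((Fin p → sylPow p k) → ℂ) →ₗ[ℂ] (sylPow p (k + 1) → ℂ) where
  toFun ψ g := if top g = 0 then ∑ r : Fin p, ψ fun i => base g (i + r) else 0
  map_add' ψ ψ' := by
    funext g
    by_cases h : top g = 0 <;> simp [h, Finset.sum_add_distrib]
  map_smul' a ψ := by
    funext g
    by_cases h : top g = 0 <;> simp [h, Finset.mul_sum]

theorem indFun_apply (ψ : (Fin p → sylPow p k) → ℂ) (g : sylPow p (k + 1)) :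
    indFun p k ψ g = if top g = 0 then ∑ r : Fin p, ψ fun i => base g (i + r) else 0 := rfl

theorem base_conj (g x : sylPow p (k + 1)) (hg : top g = 0) (i : Fin p) :
    base (x⁻¹ * g * x) i =
      (base x (i + top x))⁻¹ * base g (i + top x) * base x (i + top x) := by
  rw [base_mul, base_mul, base_inv, top_mul, top_inv, hg, add_zero, sub_neg_eq_add]

/-- Conjugating a base element by `(f; γ ^ r)` shifts its components by `r` and conjugates each of
them. The characters ignore the latter, so the sum over `f` just cancels the order of the base
group. -/
theorem inducedFromBase_eq {φ : Fin p → sylPow p k → ℂ} (h : ∀ i, IsIrrChar (φ i)) :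
    inducedFromBase φ = indFun p k (prodFun φ) := by
  have := Fintype.ofFinite (sylPow p k)
  have := Fintype.ofFinite (sylPow p (k + 1))
  funext g
  rw [inducedFromBase, inducedChar, finsum_eq_sum_of_fintype, indFun_apply]
  have h1 : ∀ (x : sylPow p (k + 1)) (f : Fin p → sylPow p k),
      baseHom p k f = x⁻¹ * g * x ↔ f = base (x⁻¹ * g * x) ∧ top g = 0 := by
    intro x f
    refine ⟨fun hf => ?_, fun ⟨hf, hg⟩ => ?_⟩
    · have h2 := congrArg top hf
      simp at h2
      exact ⟨by rw [← hf, base_baseHom], h2.symm⟩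
    · apply wreath_ext
      · rw [base_baseHom, hf]
      · simp [hg]
  split_ifs with hg
  · simp only [h1, hg, and_true, finsum_cond_eq_left, base_conj g _ hg]
    rw [sum_wreath]
    simp only [base_wreathElt, top_wreathElt, Fin.ofNat_val_eq_self, (h _).isChar.conj, prodFun,
      Finset.sum_const, Finset.card_univ, nsmul_eq_mul, Fintype.card_eq_nat_card]
    rw [← Finset.mul_sum, inv_mul_cancel_left₀ (NeZero.ne _)]
  · simp [h1, hg]

/-- The representing matrices consist of blocks numbered by `Fin p`, the cosets of the base group;
an element permutes the blocks by `top g` and acts within them through shifted components. -/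
theorem isChar_indFun {ψ : (Fin p → sylPow p k) → ℂ} (h : IsChar ψ) : IsChar (indFun p k ψ) := by
  obtain ⟨κ, _, _, σ, hσ⟩ := h
  refine ⟨Fin p × κ, inferInstance, inferInstance,
    { toFun := fun g => Matrix.of fun a b =>
        if a.1 = b.1 + top g then σ (fun i => base g (i + a.1)) a.2 b.2 else 0
      map_one' := ?_
      map_mul' := fun g h => ?_ }, fun g => ?_⟩
  · ext ⟨r, x⟩ ⟨s, y⟩
    have : (fun i => base (1 : sylPow p (k + 1)) (i + r)) = 1 := by rw [base_one]; rfl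
    simp only [Matrix.of_apply, this, map_one, top_one, add_zero, Matrix.one_apply, Prod.mk.injEq]
    split_ifs <;> simp_all
  · ext ⟨r, x⟩ ⟨s, y⟩
    simp only [Matrix.of_apply, Matrix.mul_apply', dotProduct, top_mul]
    rw [Fintype.sum_prod_type]
    simp only [ite_mul, zero_mul, mul_ite, mul_zero]
    rw [Finset.sum_eq_single (s + top h)]
    · have h1 : s + (top g + top h) = s + top h + top g := by abel
      simp only [if_true, h1]
      split_ifs with hr
      · have h2 : (fun i => base (g * h) (i + r)) =
            (fun i => base g (i + r)) * fun i => base h (i + (s + top h)) := by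
          funext i
          rw [base_mul, Pi.mul_apply, hr]
          congr 2
          abel
        rw [h2, map_mul, Matrix.mul_apply]
      · simp
    · intro t _ ht
      simp [ht]
    · simp
  · rw [indFun_apply]
    simp only [Matrix.trace, Matrix.diag, MonoidHom.coe_mk, OneHom.coe_mk, Matrix.of_apply,
      left_eq_add, Fintype.sum_prod_type, hσ]
    split_ifs <;> simp

/-- Induced functions vanish off the base group, so the form reduces to one over that group, between
sums of `p` shifts each; the factor `p⁻¹` is the inverse of its index. -/
theorem charForm_indFun [Fintype (sylPow p k)] [Fintype (sylPow p (k + 1))]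
    (ψ ψ' : (Fin p → sylPow p k) → ℂ) :
    charForm (indFun p k ψ) (indFun p k ψ') =
      (p : ℂ)⁻¹ * ∑ r : Fin p, ∑ r' : Fin p,
        charForm (fun f : Fin p → sylPow p k => ψ fun i => f (i + r))
          (fun f => ψ' fun i => f (i + r')) := by
  rw [charForm, sum_wreath, Finset.sum_eq_single 0]
  · simp only [indFun_apply, top_wreathElt, base_wreathElt, top_inv, Fin.ofNat_val_eq_self,
      if_true, neg_zero, base_inv, add_zero, charForm, Finset.sum_mul_sum]
    rw [card_sylPow_succ, Nat.cast_mul, mul_inv_rev, mul_assoc]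
    congr 1
    simp only [← Finset.mul_sum]
    congr 1
    rw [Finset.sum_comm]
    refine Finset.sum_congr rfl fun r _ => ?_
    rw [Finset.sum_comm]
    simp only [Finset.mul_sum]
    rfl
  · intro r _ hr
    simp [indFun_apply, hr]
  · simp

theorem prodFun_shift (φ : Fin p → sylPow p k → ℂ) (r : Fin p) :
    (fun f : Fin p → sylPow p k => prodFun φ fun i => f (i + r)) =
      prodFun fun i => φ (i - r) := by
  funext f
  simp only [prodFun]
  rw [← Equiv.prod_comp (Equiv.subRight r)]
  simp

/-- The periods of `φ` form a subgroup of a group of prime order; one nonzero period makes every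
element a period. -/
theorem eq_of_shift_eq_shift {α : Type*} {φ : Fin p → α} {r r' : Fin p}
    (h : ∀ i, φ (i - r) = φ (i - r')) (hne : r ≠ r') (i j : Fin p) : φ i = φ j := by
  let S : AddSubgroup (Fin p) :=
    { carrier := {d | ∀ i, φ (i + d) = φ i}
      zero_mem' := fun i => by rw [add_zero]
      add_mem' := fun {a b} ha hb i => by rw [← add_assoc, hb, ha]
      neg_mem' := fun {a} ha i => by
        rw [← ha (i + -a), neg_add_cancel_right] }
  have hS : r - r' ∈ S := fun i => by
    have := h (i + r)
    rw [add_sub_cancel_right] at this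
    rw [this, add_sub_assoc]
  have hcard : Fact (Nat.card (Fin p)).Prime := by rw [Nat.card_fin]; infer_instance
  have htop : S = ⊤ := by
    refine (S.eq_bot_or_eq_top_of_prime_card).resolve_left fun hb => ?_
    rw [hb, AddSubgroup.mem_bot, sub_eq_zero] at hS
    exact hne hS
  have : i - j ∈ S := by rw [htop]; trivial
  have := this j
  rwa [add_sub_cancel] at this

theorem isIrrChar_indFun {φ : Fin p → sylPow p k → ℂ} (h : ∀ i, IsIrrChar (φ i))
    (hne : ∃ i j, φ i ≠ φ j) : IsIrrChar (indFun p k (prodFun φ)) := by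
  have := Fintype.ofFinite (sylPow p k)
  have := Fintype.ofFinite (sylPow p (k + 1))
  rw [isIrrChar_iff]
  refine ⟨isChar_indFun (isChar_prodFun fun i => (h i).isChar), ?_⟩
  rw [charForm_indFun]
  -- Distinct shifts of a nonconstant tuple are distinct irreducible characters, so only the `p`
  -- diagonal terms contribute, and `p⁻¹` normalizes their sum to `1`.
  have h1 : ∀ r r' : Fin p, charForm (prodFun fun i => φ (i - r)) (prodFun fun i => φ (i - r')) =
      if r' = r then 1 else 0 := by
    intro r r'
    split_ifs with hr
    · rw [hr]
      exact charForm_irr_self (isIrrChar_prodFun fun i => h (i - r))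
    · refine charForm_irr_of_ne (isIrrChar_prodFun fun i => h _)
        (isIrrChar_prodFun fun i => h _) fun heq => ?_
      have h2 := prodFun_injective (fun i => h _) (fun i => h _) heq
      obtain ⟨i, j, hij⟩ := hne
      exact hij (eq_of_shift_eq_shift (fun i => congrFun h2 i) (Ne.symm hr) i j)
  simp only [prodFun_shift, h1, Finset.sum_ite_eq', Finset.mem_univ, if_true, Finset.sum_const,
    Finset.card_univ, Fintype.card_fin, nsmul_eq_mul, mul_one]
  exact inv_mul_cancel₀ (NeZero.ne _)

theorem exists_shift_of_indFun_eq {φ φ' : Fin p → sylPow p k → ℂ} (h : ∀ i, IsIrrChar (φ i))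
    (h' : ∀ i, IsIrrChar (φ' i)) (hne : ∃ i j, φ i ≠ φ j)
    (heq : indFun p k (prodFun φ) = indFun p k (prodFun φ')) :
    ∃ r : Fin p, ∀ i, φ i = φ' (i + r) := by
  have := Fintype.ofFinite (sylPow p k)
  have := Fintype.ofFinite (sylPow p (k + 1))
  by_contra! hn
  have h1 := charForm_irr_self (isIrrChar_indFun h hne)
  nth_rw 2 [heq] at h1
  rw [charForm_indFun, Finset.sum_eq_zero, mul_zero] at h1
  · exact zero_ne_one h1
  · intro r _
    refine Finset.sum_eq_zero fun r' _ => ?_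
    rw [prodFun_shift, prodFun_shift]
    refine charForm_irr_of_ne (isIrrChar_prodFun fun i => h _)
        (isIrrChar_prodFun fun i => h' _) fun heq => ?_
    -- If the terms at `r` and `r'` agreed, `φ` would be the shift of `φ'` by `r - r'`. Hence all
    -- terms vanish, against the norm `1`.
    obtain ⟨i, hi⟩ := hn (r - r')
    have h2 := congrFun (prodFun_injective (fun i => h _) (fun i => h' _) heq) (i + r)
    simp only [add_sub_cancel_right, add_sub_assoc] at h2
    exact hi h2

theorem indFun_shift (φ : Fin p → sylPow p k → ℂ) (r : Fin p) :
    indFun p k (prodFun fun i => φ (i + r)) = indFun p k (prodFun φ) := by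
  funext g
  rw [indFun_apply, indFun_apply]
  congr 1
  rw [← Equiv.sum_comp (Equiv.addRight r)]
  refine Finset.sum_congr rfl fun s _ => ?_
  simp only [prodFun]
  rw [← Equiv.prod_comp (Equiv.addRight (-r))]
  refine Finset.prod_congr rfl fun i _ => ?_
  simp only [Equiv.coe_addRight, neg_add_cancel_right]
  congr 2
  abel

theorem wreathChar_ne_indFun {φ : sylPow p k → ℂ} (h : IsIrrChar φ) (ε : ℕ)
    (ψ : (Fin p → sylPow p k) → ℂ) : wreathChar φ ε ≠ indFun p k ψ := by
  intro heq
  have h1 := congrFun heq (wreathElt 1 1)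
  have hp : 1 < p := (Fact.out : p.Prime).one_lt
  have h0 : Fin.ofNat p 1 ≠ 0 := by
    intro h
    have := congrArg Fin.val h
    simp [Nat.mod_eq_of_lt hp] at this
  rw [wreathChar_rotation, indFun_apply, top_wreathElt, if_neg h0] at h1
  exact mul_ne_zero h.one_ne_zero
    (pow_ne_zero _ ((isPrimitiveRoot_omega p).ne_zero (NeZero.ne p))) h1

/-- The sum of `ω ^ (ε s)` over `ε` is `p` for `s = 0` and `0` otherwise. An induced constant tuple
thus splits into the `p` extensions. -/
theorem indFun_const (φ : sylPow p k → ℂ) :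
    indFun p k (prodFun fun _ => φ) = ∑ ε : Fin p, wreathChar φ ε := by
  funext g
  rw [indFun_apply, Finset.sum_apply]
  simp only [wreathChar, ← Finset.mul_sum]
  split_ifs with hg
  · simp only [hg, Fin.val_zero, pow_zero, Finset.sum_const, Finset.card_univ, Fintype.card_fin,
      nsmul_eq_mul, mul_one]
    rw [Finset.sum_congr rfl fun r _ => ?_, Finset.sum_const, Finset.card_univ, Fintype.card_fin,
      nsmul_eq_mul, mul_comm]
    exact Equiv.prod_comp (Equiv.addRight r) fun i => φ (base g i)
  · have h1 : IsPrimitiveRoot (omega p ^ (top g : ℕ)) p := by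
      refine (isPrimitiveRoot_omega p).pow_of_coprime _ ?_
      rw [Nat.coprime_comm]
      exact (Nat.Prime.coprime_iff_not_dvd Fact.out).mpr fun hd => hg
        (Fin.ext (Nat.eq_zero_of_dvd_of_lt hd (top g).2))
    have h2 := h1.geom_sum_eq_zero (Fact.out : p.Prime).one_lt
    rw [← Fin.sum_univ_eq_sum_range (fun i => (omega p ^ (top g : ℕ)) ^ i)] at h2
    simp only [← pow_mul, mul_comm (top g : ℕ)] at h2
    simp only [← pow_mul, h2, mul_zero]

/-- The irreducible characters of `P_{p^{k+1}}`. -/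
def wreathIrr (p k : ℕ) [Fact p.Prime] : Set (sylPow p (k + 1) → ℂ) :=
  {θ | (∃ (φ : sylPow p k → ℂ) (ε : Fin p), IsIrrChar φ ∧ θ = wreathChar φ ε) ∨
    ∃ φ : Fin p → sylPow p k → ℂ, (∀ i, IsIrrChar (φ i)) ∧ (∃ i j, φ i ≠ φ j) ∧
      θ = indFun p k (prodFun φ)}

theorem isIrrChar_of_mem_wreathIrr {θ : sylPow p (k + 1) → ℂ} (h : θ ∈ wreathIrr p k) :
    IsIrrChar θ := by
  obtain ⟨φ, ε, hφ, rfl⟩ | ⟨φ, hφ, hne, rfl⟩ := h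
  · exact isIrrChar_wreathChar hφ _
  · exact isIrrChar_indFun hφ hne

theorem unitFun_mem_span_wreathIrr (h : UnitFunSpanned (sylPow p k)) :
    unitFun (sylPow p (k + 1)) ∈ Submodule.span ℂ (wreathIrr p k) := by
  have h1 : unitFun (sylPow p (k + 1)) =
      (p : ℂ)⁻¹ • indFun p k (unitFun (Fin p → sylPow p k)) := by
    funext g
    have h2 : ∀ r : Fin p, (fun i => base g (i + r)) = 1 ↔ base g = 1 := fun r =>
      ⟨fun h => funext fun i => by simpa using congrFun h (i - r), fun h => by rw [h]; rfl⟩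
    have h3 : g = 1 ↔ top g = 0 ∧ base g = 1 :=
      ⟨fun h => by rw [h]; exact ⟨top_one, base_one⟩,
        fun h => wreath_ext (h.2.trans base_one.symm) (h.1.trans top_one.symm)⟩
    have hp : (p : ℂ) ≠ 0 := NeZero.ne _
    rw [Pi.smul_apply, indFun_apply]
    simp only [unitFun, h2, h3]
    by_cases ht : top g = 0 <;> by_cases hb : base g = 1 <;> simp [ht, hb, hp]
  rw [h1]
  refine Submodule.smul_mem _ _ ?_
  have h4 := Submodule.mem_map_of_mem (f := indFun p k) (unitFun_pi_mem_span fun _ : Fin p => h)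
  rw [Submodule.map_span] at h4
  refine Submodule.span_le.mpr ?_ h4
  rintro _ ⟨_, ⟨φ, hφ, rfl⟩, rfl⟩
  -- A product of irreducible characters induces to an irreducible character if its factors are not
  -- all equal, and otherwise to a sum of extensions.
  by_cases hne : ∃ i j, φ i ≠ φ j
  · exact Submodule.subset_span (Or.inr ⟨φ, hφ, hne, rfl⟩)
  · push Not at hne
    have : φ = fun _ => φ 0 := funext fun i => hne i 0
    rw [this, indFun_const]
    exact Submodule.sum_mem _ fun ε _ => Submodule.subset_span (Or.inl ⟨φ 0, ε, hφ 0, rfl⟩)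

theorem isIrrChar_sylPow_zero {q : ℕ} {θ : sylPow q 0 → ℂ} : IsIrrChar θ ↔ θ = 1 := by
  have hs : Subsingleton (sylPow q 0) := by
    rw [sylPow]
    infer_instance
  have := Fintype.ofFinite (sylPow q 0)
  have h1 : IsIrrChar (1 : sylPow q 0 → ℂ) := by
    rw [isIrrChar_iff]
    refine ⟨⟨Unit, inferInstance, inferInstance, 1, fun g => ?_⟩, ?_⟩
    · show (1 : ℂ) = (1 : Matrix Unit Unit ℂ).trace
      simp
    rw [charForm]
    simp only [Pi.one_apply, mul_one, Finset.sum_const, Finset.card_univ, nsmul_eq_mul,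
      Fintype.card_eq_nat_card]
    exact inv_mul_cancel₀ (NeZero.ne _)
  refine ⟨fun h => ?_, fun h => h ▸ h1⟩
  refine h.eq_of_proportional h1 (a := 1) (b := θ 1) h.one_ne_zero fun g => ?_
  rw [Subsingleton.elim g 1]
  simp

theorem unitFunSpanned_sylPow (p k : ℕ) [Fact p.Prime] : UnitFunSpanned (sylPow p k) := by
  induction k with
  | zero =>
    have hs : Subsingleton (sylPow p 0) := by
      rw [sylPow]
      infer_instance
    refine Submodule.subset_span (isIrrChar_sylPow_zero.mpr ?_)
    funext g
    rw [Subsingleton.elim g 1]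
    exact if_pos rfl
  | succ k ih =>
    exact Submodule.span_mono (fun θ hθ => isIrrChar_of_mem_wreathIrr hθ)
      (unitFun_mem_span_wreathIrr ih)

theorem IsIrrChar.mem_wreathIrr {θ : sylPow p (k + 1) → ℂ} (h : IsIrrChar θ) :
    θ ∈ wreathIrr p k :=
  h.mem_of_unitFun_mem_span (fun _ hχ => isIrrChar_of_mem_wreathIrr hχ)
    (unitFun_mem_span_wreathIrr (unitFunSpanned_sylPow p k))

end WreathCharacters

/-! ### Equivalence of labeling functions, one level at a time -/

section TreeFunctions

variable {p k : ℕ}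

theorem node_child (t : Labeling p (k + 1)) : node (child t) (rootLabel t) = t := by
  funext ⟨s, hs⟩
  cases s <;> rfl

theorem node_apply_of_eq_cons (f : Fin p → Labeling p k) (ε : Fin (p + 1)) {s q : List (Fin p)}
    {i : Fin p} (h : s = i :: q) (hs : s.length < k + 1) :
    node f ε ⟨s, hs⟩ = f i ⟨q, by rw [h] at hs; exact Nat.lt_of_succ_lt_succ hs⟩ := by
  subst h
  rfl

theorem node_apply_of_eq_nil (f : Fin p → Labeling p k) (ε : Fin (p + 1)) {s : List (Fin p)}
    (h : s = []) (hs : s.length < k + 1) : node f ε ⟨s, hs⟩ = ε := by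
  subst h
  rfl

/-- The root element `γ []` is a cyclic shift of the children, and the elements `γ (i :: q)` twist
the `i`-th child independently of the others. Conversely, such data glue to one family. -/
theorem node_equiv_node_iff [NeZero p] {f f' : Fin p → Labeling p k} {ε ε' : Fin (p + 1)} :
    (⟦node f ε⟧ : TreeFun p (k + 1)) = ⟦node f' ε'⟧ ↔
      ε = ε' ∧ ∃ r : Fin p, ∀ i, (⟦f i⟧ : TreeFun p k) = ⟦f' (i + r)⟧ := by
  simp only [Quotient.eq]
  constructor
  · rintro ⟨γ, h⟩
    refine ⟨?_, ?_⟩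
    · have := h ⟨[], Nat.succ_pos k⟩
      rwa [node_apply_of_eq_nil _ _ rfl, node_apply_of_eq_nil _ _ (twist_nil γ)] at this
    · obtain ⟨r, hr⟩ := (mem_zpowers_finRotate_iff _).mp (γ []).2
      refine ⟨r, fun i => ⟨fun q => γ (i :: q), fun s => ?_⟩⟩
      have := h ⟨i :: s.1, Nat.succ_lt_succ s.2⟩
      rw [node_apply_of_eq_cons _ _ rfl, node_apply_of_eq_cons _ _ (twist_cons γ i s.1)] at this
      rw [← hr i]
      exact this
  · rintro ⟨rfl, r, h⟩
    choose γ hγ using h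
    let δ : List (Fin p) → Subgroup.zpowers (finRotate p)
      | [] => ⟨Equiv.addRight r, (mem_zpowers_finRotate_iff _).mpr ⟨r, fun _ => rfl⟩⟩
      | i :: q => γ i q
    refine ⟨δ, fun ⟨s, hs⟩ => ?_⟩
    cases s with
    | nil => rw [node_apply_of_eq_nil _ _ rfl, node_apply_of_eq_nil _ _ (twist_nil δ)]
    | cons i q =>
      rw [node_apply_of_eq_cons _ _ rfl, node_apply_of_eq_cons _ _ (twist_cons δ i q)]
      exact hγ i ⟨q, Nat.lt_of_succ_lt_succ hs⟩

theorem treeFun_node_eq [NeZero p] {f f' : Fin p → Labeling p k} {ε : Fin (p + 1)}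
    (h : ∀ i, (⟦f i⟧ : TreeFun p k) = ⟦f' i⟧) :
    (⟦node f ε⟧ : TreeFun p (k + 1)) = ⟦node f' ε⟧ :=
  node_equiv_node_iff.mpr ⟨rfl, 0, fun i => by rw [add_zero, h]⟩

theorem relabel_node (τ : Fin (p + 1) → Fin (p + 1)) (f : Fin p → Labeling p k)
    (ε : Fin (p + 1)) : TreeFun.relabel τ (⟦node f ε⟧ : TreeFun p (k + 1)) =
      ⟦node (fun i s => τ (f i s)) (τ ε)⟧ := by
  refine congrArg (Quotient.mk _) ?_
  funext ⟨s, hs⟩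
  cases s <;> rfl

instance subsingleton_treeFun_zero : Subsingleton (TreeFun p 0) :=
  ⟨fun S T => by
    induction S using Quotient.inductionOn
    induction T using Quotient.inductionOn
    exact congrArg (Quotient.mk _) (funext fun s => absurd s.2 (Nat.not_lt_zero _))⟩

end TreeFunctions

/-! ### The bijection for `P_{p^k}` -/

section Correspondence

variable {p k : ℕ} [Fact p.Prime]

theorem isTreeFunOf_succ_iff {θ : sylPow p (k + 1) → ℂ} {T : TreeFun p (k + 1)} :
    IsTreeFunOf (k + 1) θ T ↔
    (∃ (φ : sylPow p k → ℂ) (ε : Fin p) (t : Labeling p k),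
      IsIrrChar φ ∧ θ = wreathChar φ ε ∧ IsTreeFunOf k φ ⟦t⟧ ∧
        T = ⟦node (fun _ => t) ε.castSucc⟧) ∨
    (∃ (φ : Fin p → sylPow p k → ℂ) (t : Fin p → Labeling p k),
      (∀ i, IsIrrChar (φ i)) ∧ (∃ i j, φ i ≠ φ j) ∧ θ = indFun p k (prodFun φ) ∧
        (∀ i, IsTreeFunOf k (φ i) ⟦t i⟧) ∧ T = ⟦node t (Fin.last p)⟧) := by
  refine or_congr ?_ ?_
  · refine exists_congr fun φ => exists_congr fun ε => exists_congr fun t => ?_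
    exact and_congr_right fun hφ => by rw [isWreathChar_iff hφ]
  · refine exists_congr fun φ => exists_congr fun t => ?_
    exact and_congr_right fun hφ => by rw [inducedFromBase_eq hφ]

theorem IsTreeFunOf.isIrrChar {θ : sylPow p k → ℂ} {T : TreeFun p k} (h : IsTreeFunOf k θ T) :
    IsIrrChar θ := by
  cases k with
  | zero => exact isIrrChar_sylPow_zero.mpr h
  | succ k =>
    obtain ⟨φ, ε, t, hφ, rfl, -⟩ | ⟨φ, t, hφ, hne, rfl, -⟩ := isTreeFunOf_succ_iff.mp h
    · exact isIrrChar_wreathChar hφ _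
    · exact isIrrChar_indFun hφ hne

/-- The root label separates the two types. Equal nodes have equal children up to a shift, and a
shift does not change the induced character. -/
theorem IsTreeFunOf.char_unique {θ θ' : sylPow p k → ℂ} {T : TreeFun p k}
    (h : IsTreeFunOf k θ T) (h' : IsTreeFunOf k θ' T) : θ = θ' := by
  induction k with
  | zero => exact Eq.trans h (Eq.symm h')
  | succ k ih =>
    obtain ⟨φ, ε, t, hφ, rfl, ht, rfl⟩ | ⟨φ, t, hφ, hne, rfl, ht, rfl⟩ :=
        isTreeFunOf_succ_iff.mp h <;>
      obtain ⟨φ', ε', t', hφ', rfl, ht', hT⟩ | ⟨φ', t', hφ', hne', rfl, ht', hT⟩ :=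
        isTreeFunOf_succ_iff.mp h' <;>
      obtain ⟨h1, r, h2⟩ := node_equiv_node_iff.mp hT
    · rw [Fin.castSucc_injective p h1]
      rw [h2 0] at ht
      rw [ih ht ht']
    · exact absurd h1 (Fin.castSucc_ne_last _)
    · exact absurd h1.symm (Fin.castSucc_ne_last _)
    · have h3 : φ = fun i => φ' (i + r) := funext fun i => by
        have := ht i
        rw [h2 i] at this
        exact ih this (ht' (i + r))
      rw [h3, indFun_shift]

/-- The two types of characters are disjoint, an extension determines `φ` and `ε`, and an induced
character determines its tuple up to a shift, which node equivalence absorbs. -/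
theorem IsTreeFunOf.treeFun_unique {θ : sylPow p k → ℂ} {T T' : TreeFun p k}
    (h : IsTreeFunOf k θ T) (h' : IsTreeFunOf k θ T') : T = T' := by
  induction k with
  | zero => exact Subsingleton.elim _ _
  | succ k ih =>
    obtain ⟨φ, ε, t, hφ, hθ, ht, rfl⟩ | ⟨φ, t, hφ, hne, hθ, ht, rfl⟩ :=
        isTreeFunOf_succ_iff.mp h <;>
      obtain ⟨φ', ε', t', hφ', hθ', ht', rfl⟩ | ⟨φ', t', hφ', hne', hθ', ht', rfl⟩ :=
        isTreeFunOf_succ_iff.mp h' <;>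
      rw [hθ] at hθ'
    · obtain ⟨rfl, rfl⟩ := wreathChar_injective hφ hφ' hθ'
      exact treeFun_node_eq fun _ => ih ht ht'
    · exact absurd hθ' (wreathChar_ne_indFun hφ _ _)
    · exact absurd hθ'.symm (wreathChar_ne_indFun hφ' _ _)
    · obtain ⟨r, hr⟩ := exists_shift_of_indFun_eq hφ hφ' hne hθ'
      refine node_equiv_node_iff.mpr ⟨rfl, r, fun i => ?_⟩
      have := ht i
      rw [hr i] at this
      exact ih this (ht' (i + r))

theorem IsTreeFunOf.isAdmissible {θ : sylPow p k → ℂ} {T : TreeFun p k}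
    (h : IsTreeFunOf k θ T) : T.IsAdmissible := by
  induction k with
  | zero =>
    induction T using Quotient.inductionOn with
    | h t => exact ⟨t, rfl, trivial⟩
  | succ k ih =>
    obtain ⟨φ, ε, t, hφ, rfl, ht, rfl⟩ | ⟨φ, t, hφ, hne, rfl, ht, rfl⟩ :=
        isTreeFunOf_succ_iff.mp h
    · obtain ⟨t', ht', hadm⟩ := ih ht
      refine ⟨node (fun _ => t') ε.castSucc, treeFun_node_eq fun _ => ht',
        fun _ => hadm, fun _ i j => Setoid.refl t', fun hl => ?_⟩
      exact absurd hl (Fin.castSucc_ne_last _)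
    · choose t' ht' hadm using fun i => ih (ht i)
      refine ⟨node t' (Fin.last p), treeFun_node_eq ht', fun i => hadm i,
        fun hl => absurd rfl hl, fun _ => ?_⟩
      obtain ⟨i, j, hij⟩ := hne
      -- Different characters have inequivalent trees, by `char_unique` at the lower level.
      refine ⟨i, j, fun heq => hij ?_⟩
      have h1 : (⟦t i⟧ : TreeFun p k) = ⟦t j⟧ := by
        rw [← ht' i, ← ht' j]
        exact Quotient.sound heq
      have h2 := ht i
      rw [h1] at h2
      exact h2.char_unique (ht j)

theorem IsIrrChar.exists_isTreeFunOf {θ : sylPow p k → ℂ} (h : IsIrrChar θ) :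
    ∃ T, IsTreeFunOf k θ T := by
  induction k with
  | zero =>
    exact ⟨⟦fun _ => 0⟧, isIrrChar_sylPow_zero.mp h⟩
  | succ k ih =>
    obtain ⟨φ, ε, hφ, rfl⟩ | ⟨φ, hφ, hne, rfl⟩ := h.mem_wreathIrr
    · obtain ⟨T, hT⟩ := ih hφ
      obtain ⟨t, rfl⟩ := Quotient.exists_rep T
      exact ⟨_, isTreeFunOf_succ_iff.mpr (Or.inl ⟨φ, ε, t, hφ, rfl, hT, rfl⟩)⟩
    · choose T hT using fun i => ih (hφ i)
      choose t ht using fun i => Quotient.exists_rep (T i)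
      exact ⟨_, isTreeFunOf_succ_iff.mpr (Or.inr ⟨φ, t, hφ, hne, rfl,
        fun i => by rw [ht]; exact hT i, rfl⟩)⟩

theorem Admissible.exists_isTreeFunOf {t : Labeling p k} (h : Admissible t) :
    ∃ θ, IsTreeFunOf k θ ⟦t⟧ := by
  induction k with
  | zero => exact ⟨1, rfl⟩
  | succ k ih =>
    obtain ⟨h1, h2, h3⟩ := h
    choose φ hφ using fun i => ih (h1 i)
    by_cases hl : rootLabel t = Fin.last p
    · obtain ⟨i, j, hij⟩ := h3 hl
      -- Inequivalent children belong to different characters, by `treeFun_unique`, so the tuple may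
      -- be induced.
      refine ⟨_, isTreeFunOf_succ_iff.mpr (Or.inr ⟨φ, child t, fun i => (hφ i).isIrrChar,
        ⟨i, j, fun heq => hij (Quotient.exact ?_)⟩, rfl, hφ, ?_⟩)⟩
      · have := hφ i
        rw [heq] at this
        exact this.treeFun_unique (hφ j)
      · rw [← hl, node_child]
    · obtain ⟨ε, hε⟩ := Fin.exists_castSucc_eq.mpr hl
      refine ⟨_, isTreeFunOf_succ_iff.mpr (Or.inl ⟨φ 0, ε, child t 0, (hφ 0).isIrrChar, rfl,
        hφ 0, ?_⟩)⟩
      rw [hε]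
      conv_lhs => rw [← node_child t]
      exact treeFun_node_eq fun i => Quotient.sound (h2 hl i 0)

end Correspondence

/-! ### Galois conjugation of character values -/

section Galois

variable {p k : ℕ} (σ : cycField p ≃ₐ[ℚ] cycField p)

/-- `z` lies in `ℚ(ω)`, and `σ` maps it to `w`. -/
def GaloisMaps (z w : ℂ) : Prop :=
  ∃ x : cycField p, (x : ℂ) = z ∧ ((σ x : cycField p) : ℂ) = w

variable {σ}

theorem GaloisMaps.mul {z w z' w' : ℂ} (h : GaloisMaps σ z w) (h' : GaloisMaps σ z' w') :
    GaloisMaps σ (z * z') (w * w') := by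
  obtain ⟨x, rfl, rfl⟩ := h
  obtain ⟨y, rfl, rfl⟩ := h'
  exact ⟨x * y, rfl, by rw [map_mul]; rfl⟩

theorem GaloisMaps.pow {z w : ℂ} (h : GaloisMaps σ z w) (m : ℕ) :
    GaloisMaps σ (z ^ m) (w ^ m) := by
  obtain ⟨x, rfl, rfl⟩ := h
  exact ⟨x ^ m, rfl, by rw [map_pow]; rfl⟩

theorem GaloisMaps.zero : GaloisMaps σ 0 0 := ⟨0, rfl, by rw [map_zero]; rfl⟩

theorem GaloisMaps.one : GaloisMaps σ 1 1 := ⟨1, rfl, by rw [map_one]; rfl⟩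

theorem GaloisMaps.prod {ι : Type*} [Fintype ι] {z w : ι → ℂ} (h : ∀ i, GaloisMaps σ (z i) (w i)) :
    GaloisMaps σ (∏ i, z i) (∏ i, w i) := by
  choose x hx hy using h
  exact ⟨∏ i, x i, by simp [hx], by simp [hy]⟩

theorem GaloisMaps.sum {ι : Type*} [Fintype ι] {z w : ι → ℂ} (h : ∀ i, GaloisMaps σ (z i) (w i)) :
    GaloisMaps σ (∑ i, z i) (∑ i, w i) := by
  choose x hx hy using h
  exact ⟨∑ i, x i, by simp [hx], by simp [hy]⟩

/-- Injectivity of `σ` keeps different characters different after conjugation, so the induced type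
is preserved. -/
theorem GaloisMaps.injective {z z' w : ℂ} (h : GaloisMaps σ z w) (h' : GaloisMaps σ z' w) :
    z = z' := by
  obtain ⟨x, rfl, hx⟩ := h
  obtain ⟨y, rfl, hy⟩ := h'
  rw [σ.injective (Subtype.ext (hx.trans hy.symm))]

theorem IsGaloisConj.injective {G : Type} {θ θ' ψ : G → ℂ} (h : IsGaloisConj σ θ ψ)
    (h' : IsGaloisConj σ θ' ψ) : θ = θ' :=
  funext fun g => GaloisMaps.injective (h g) (h' g)

variable [Fact p.Prime] {b : ℕ}
  (hb : σ (IntermediateField.AdjoinSimple.gen ℚ (omega p)) =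
    IntermediateField.AdjoinSimple.gen ℚ (omega p) ^ b)

include hb in
theorem galoisMaps_omega_pow (ε : ℕ) : GaloisMaps σ (omega p ^ ε) (omega p ^ (b * ε % p)) := by
  have h1 : GaloisMaps σ (omega p) (omega p ^ b) :=
    ⟨IntermediateField.AdjoinSimple.gen ℚ (omega p), rfl, by rw [hb]; rfl⟩
  have h2 := omega_pow_pow_mod (p := p) 1 (b * ε)
  rw [pow_one] at h2
  rw [h2, pow_mul]
  exact h1.pow ε

include hb in
theorem isGaloisConj_wreathChar {φ φ' : sylPow p k → ℂ} (h : IsGaloisConj σ φ φ') (ε : ℕ) :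
    IsGaloisConj σ (wreathChar φ ε) (wreathChar φ' (b * ε % p)) := by
  intro g
  refine GaloisMaps.mul ?_ ((galoisMaps_omega_pow hb ε).pow _)
  split_ifs
  · exact GaloisMaps.prod fun i => h _
  · exact h _

theorem isGaloisConj_indFun {φ φ' : Fin p → sylPow p k → ℂ}
    (h : ∀ i, IsGaloisConj σ (φ i) (φ' i)) :
    IsGaloisConj σ (indFun p k (prodFun φ)) (indFun p k (prodFun φ')) := by
  intro g
  rw [indFun_apply, indFun_apply]
  split_ifs
  · exact GaloisMaps.sum fun r => GaloisMaps.prod fun i => h i _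
  · exact GaloisMaps.zero

-- The conjugate is constructed together with its tree function, and having a tree function already
-- makes it irreducible; no conjugate representation is needed.
include hb in
theorem IsTreeFunOf.exists_galoisConj {θ : sylPow p k → ℂ} {T : TreeFun p k}
    (h : IsTreeFunOf k θ T) :
    ∃ θ' : sylPow p k → ℂ, IsGaloisConj σ θ θ' ∧ IsTreeFunOf k θ' (T.relabel (tau p b)) := by
  induction k with
  | zero =>
    refine ⟨1, ?_, rfl⟩
    rw [show θ = 1 from h]
    exact fun g => GaloisMaps.one
  | succ k ih =>
    obtain ⟨φ, ε, t, hφ, rfl, ht, rfl⟩ | ⟨φ, t, hφ, hne, rfl, ht, rfl⟩ :=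
        isTreeFunOf_succ_iff.mp h
    · obtain ⟨φ', hg, ht'⟩ := ih ht
      refine ⟨_, isGaloisConj_wreathChar hb hg ε, isTreeFunOf_succ_iff.mpr (Or.inl
        ⟨φ', ⟨b * ε % p, Nat.mod_lt _ (Fact.out : p.Prime).pos⟩, fun s => tau p b (t s),
          ht'.isIrrChar, rfl, ht', ?_⟩)⟩
      rw [relabel_node]
      have : tau p b ε.castSucc =
          Fin.castSucc ⟨b * ε % p, Nat.mod_lt _ (Fact.out : p.Prime).pos⟩ := by
        rw [tau, if_neg (Fin.castSucc_ne_last _)]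
        rfl
      rw [this]
    · choose φ' hg ht' using fun i => ih (ht i)
      refine ⟨_, isGaloisConj_indFun hg, isTreeFunOf_succ_iff.mpr (Or.inr
        ⟨φ', fun i s => tau p b (t i s), fun i => (ht' i).isIrrChar, ?_, rfl, ht', ?_⟩)⟩
      · obtain ⟨i, j, hij⟩ := hne
        refine ⟨i, j, fun heq => hij ?_⟩
        have := hg i
        rw [heq] at this
        exact this.injective (hg j)
      · rw [relabel_node, tau, if_pos rfl]

end Galois

/-! ### Passage to the direct product `P_n` -/

namespace PadicExpansion

variable {p n : ℕ} (E : PadicExpansion p n)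

theorem blockHom_injective : Function.Injective E.blockHom := by
  intro x y h
  have h1 := E.pointEquiv.permCongrHom.injective h
  funext c
  refine Subtype.ext (Equiv.ext fun z => ?_)
  have h2 := Equiv.congr_fun h1 ⟨c.1, c.2, z⟩
  simpa [blockAct] using h2

/-- The isomorphism of the direct product of the groups `P_{p^{k_i}}` with `P_n`. -/
noncomputable def prodEquiv : ((c : E.Factor) → sylPow p (E.k c.1)) ≃* E.sylow :=
  MonoidHom.ofInjective E.blockHom_injective

theorem isProductOf_iff {θ : E.sylow → ℂ} {φ : (c : E.Factor) → sylPow p (E.k c.1) → ℂ} :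
    E.IsProductOf θ φ ↔ θ = prodFun φ ∘ E.prodEquiv.symm := by
  have h1 : ∀ x, E.blockHom.rangeRestrict x = E.prodEquiv x := fun _ => rfl
  refine ⟨fun h => ?_, fun h x => ?_⟩
  · funext g
    have := h (E.prodEquiv.symm g)
    rwa [h1, MulEquiv.apply_symm_apply] at this
  · rw [h, h1, Function.comp_apply, MulEquiv.symm_apply_apply]
    rfl

theorem IsNTreeFunOf.isIrrChar {θ : E.sylow → ℂ} {T : E.NTreeFun} (h : E.IsNTreeFunOf θ T) :
    IsIrrChar θ := by
  obtain ⟨φ, hφ, hθ, -⟩ := h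
  rw [E.isProductOf_iff.mp hθ]
  exact isIrrChar_comp_mulEquiv _ (isIrrChar_prodFun hφ)

variable [Fact p.Prime]

theorem exists_isNTreeFunOf {θ : E.sylow → ℂ} (hθ : IsIrrChar θ) : ∃ T, E.IsNTreeFunOf θ T := by
  obtain ⟨φ, hφ, h⟩ := (isIrrChar_comp_mulEquiv E.prodEquiv hθ).exists_eq_prodFun
    fun c => unitFunSpanned_sylPow p (E.k c.1)
  choose T hT using fun c => (hφ c).exists_isTreeFunOf
  refine ⟨T, φ, hφ, E.isProductOf_iff.mpr ?_, hT⟩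
  rw [h]
  funext g
  simp

theorem IsNTreeFunOf.treeFun_unique {θ : E.sylow → ℂ} {S T : E.NTreeFun}
    (hS : E.IsNTreeFunOf θ S) (hT : E.IsNTreeFunOf θ T) : S = T := by
  obtain ⟨φ, hφ, hθ, hφS⟩ := hS
  obtain ⟨φ', hφ', hθ', hφT⟩ := hT
  rw [E.isProductOf_iff] at hθ hθ'
  have h1 : prodFun φ = prodFun φ' :=
    E.prodEquiv.symm.surjective.injective_comp_right (hθ.symm.trans hθ')
  obtain rfl := prodFun_injective hφ hφ' h1
  exact funext fun c => (hφS c).treeFun_unique (hφT c)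

theorem IsNTreeFunOf.char_unique {θ θ' : E.sylow → ℂ} {T : E.NTreeFun}
    (h : E.IsNTreeFunOf θ T) (h' : E.IsNTreeFunOf θ' T) : θ = θ' := by
  obtain ⟨φ, hφ, hθ, hφT⟩ := h
  obtain ⟨φ', hφ', hθ', hφT'⟩ := h'
  have h1 : φ = φ' := funext fun c => (hφT c).char_unique (hφT' c)
  rw [E.isProductOf_iff] at hθ hθ'
  rw [hθ, hθ', h1]

theorem exists_isNTreeFunOf_of_isAdmissible {T : E.NTreeFun} (h : ∀ c, (T c).IsAdmissible) :
    ∃ θ, E.IsNTreeFunOf θ T := by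
  choose t ht hadm using h
  choose φ hφ using fun c => (hadm c).exists_isTreeFunOf
  exact ⟨_, φ, fun c => (hφ c).isIrrChar, E.isProductOf_iff.mpr rfl,
    fun c => by rw [← ht c]; exact hφ c⟩

end PadicExpansion

end SylowTree
/-- Let `P_n` be the Sylow `p`-subgroup of `S_n`, and let `σ` be a generator of `Gal(ℚ(ω)/ℚ)` with
`ω^σ = ω^b`. Every admissible `n`-tree function is that of exactly one irreducible character of
`P_n`. Let `θ` be an irreducible character of `P_n`. Then `θ^σ` is defined and irreducible, `θ` has
exactly one `n`-tree function `T = (T_1, …, T_{q_t})`, it is admissible, and the only `n`-tree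
function of `θ^σ` is obtained by applying `τ` to all labels of all `T_j`. -/
theorem theorem4 (p : ℕ) [Fact p.Prime] (n : ℕ) (E : SylowTree.PadicExpansion p n)
    (σ : SylowTree.cycField p ≃ₐ[ℚ] SylowTree.cycField p) (hσ : Subgroup.zpowers σ = ⊤)
    (b : ℕ) (hb1 : 1 ≤ b) (hbp : b ≤ p - 1)
    (hb : σ (IntermediateField.AdjoinSimple.gen ℚ (SylowTree.omega p)) =
      IntermediateField.AdjoinSimple.gen ℚ (SylowTree.omega p) ^ b) :
    (∀ T : E.NTreeFun, (∀ c, (T c).IsAdmissible) →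
      ∃! θ : E.sylow → ℂ, SylowTree.IsIrrChar θ ∧ E.IsNTreeFunOf θ T) ∧
    ∀ θ : E.sylow → ℂ, SylowTree.IsIrrChar θ →
      ∃ θσ : E.sylow → ℂ, SylowTree.IsGaloisConj σ θ θσ ∧ SylowTree.IsIrrChar θσ ∧
        ∃ T : E.NTreeFun, (∀ c, (T c).IsAdmissible) ∧
          (∀ S : E.NTreeFun, E.IsNTreeFunOf θ S ↔ S = T) ∧
          (∀ S : E.NTreeFun, E.IsNTreeFunOf θσ S ↔
            S = fun c => (T c).relabel (SylowTree.tau p b)) := by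
  refine ⟨fun T hT => ?_, fun θ hθ => ?_⟩
  · obtain ⟨θ, hθ⟩ := E.exists_isNTreeFunOf_of_isAdmissible hT
    exact ⟨θ, ⟨hθ.isIrrChar, hθ⟩, fun θ' h => h.2.char_unique E hθ⟩
  · obtain ⟨T, hT⟩ := E.exists_isNTreeFunOf hθ
    obtain ⟨φ, hφ, hprod, hφT⟩ := id hT
    choose φ' hconj hφT' using fun c => (hφT c).exists_galoisConj hb
    -- Products commute with `σ`, so the conjugate of `θ` is assembled from the conjugates of its
    -- factors.
    let θ' : E.sylow → ℂ := SylowTree.prodFun φ' ∘ E.prodEquiv.symm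
    have hT' : E.IsNTreeFunOf θ' fun c => (T c).relabel (SylowTree.tau p b) :=
      ⟨φ', fun c => (hφT' c).isIrrChar, E.isProductOf_iff.mpr rfl, hφT'⟩
    refine ⟨θ', ?_, hT'.isIrrChar, T, fun c => (hφT c).isAdmissible,
      fun S => ⟨fun hS => hS.treeFun_unique E hT, fun hS => hS ▸ hT⟩,
      fun S => ⟨fun hS => hS.treeFun_unique E hT', fun hS => hS ▸ hT'⟩⟩
    intro g
    rw [E.isProductOf_iff.mp hprod]
    exact SylowTree.GaloisMaps.prod fun c => hconj c _
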